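/- **Model.** Registers are quantum or classical and finite-dimensional; protocol, simulator and adversary registers start at $0$, and the application's private registers start at arbitrary basis values. A gate is a classically controlled operation: a unitary on quantum registers, a permutation of the values of classical registers, or a measurement of a quantum register whose outcome is added to a classical register. A *circuit* is a finite set of gates with a strict partial order, which may depend on the initial values of the registers, in which any two gates that access a common register are ordered. It is executed in any order compatible with the partial order. A *protocol* $P$ is a finite set of module-role-circuits $r$ with private registers, internal channel registers, input/output channel registers and activation registers (a communication gate is executed only if its activation register has been set, and every gate that sets this register precedes it). Each channel register has a channel-type, which says whether it may be read, or read and modified, in the name of $r$ and in nobody's name. A circuit $r$ is not corruptible, or has a corruption bit $C_r$ that switches its gates off, or is a passive auxiliary circuit that is corrupted all the time. An *environment* $E=App+Adv$ for $P$ is a circuit together with a partial order on the gates of $E+P$ that makes $E+P$ a circuit. The application $App$ holds the output bit $Z$ among private registers of its own, may change the corruption bits, may use the input/output channels, and may also interact directly with the internal channel registers of $P$ in accordance with their channel-types. The adversary $Adv$ consists of circuits $A(r)$ that are active only when $r$ is corrupted; they do not access the application's private registers, and use the registers of $r$ and the channel registers in accordance with their channel-types, possibly in the name of $r$. An *ideal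 protocol* $I(P)$ is a protocol containing circuits $I(r)$ for some of the circuits $r$ of $P$, with the same corruption status and input/output channels as $r$, plus non-corruptible circuits; its other registers are its own. On the ideal side the private and internal channel registers of $P$ are free. A *simulator* $S$ and an *ideal adversary* $Adv'$ may use these freely and may read corruption bits; they use the input/output channels of a circuit $r$, and the registers of $I(P)$ through a circuit $I(r)$, only while $r$ is corrupted and in accordance with the channel-types. A simulator accesses no register of the environment (that is not a register of $P$); an ideal adversary accesses no private register of the application. The partial orders on $App+Adv+S+I(P)$ and $App+Adv'+I(P)$ extend those of $I(P)$ and of $E$, respectively of $App$, and make these settings circuits. The size of a circuit is its number of gates. **Definitions.** Let $\varepsilon$ be a real function of the environment, and fix a class of valid environments. * (Original) $P$ *$\varepsilon$-securely realizes* $I(P)$ if for every $E=App+Adv$ in the class there is a valid simulator $S$ such that, for all initial values of the application's private registers, $|\Pr(Z_{App+Adv+P}=0)-\Pr(Z_{App+Adv+S+I(P)}=0)|\le\varepsilon(E)$. * (Alternative) The same, but with a valid ideal adversary $Adv'$ and the ideal side $App+Adv'+I(P)$. * (Computational versions) $P=(P_n)$ and $I=(I_n)$ have polynomial size, and there is one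 function $\varepsilon(n,s)$ that is negligible (for every polynomially bounded $f$ and every positive polynomial $q$, $\varepsilon(n,f(n))\le 1/q(n)$ for all large $n$) such that for every polynomial-size family $(E_n)$ of environments in the class there is a polynomial-size family of simulators (respectively ideal adversaries) satisfying the bound with $\varepsilon(n,|E_n|)$ for every $n$. A *dummy* environment is one whose adversary only forwards: each of its gates, controlled by nothing but the corruption bit, exchanges registers of $P$ with registers of the environment, or copies classical values from the former to the latter, or erases such copies. $P$ *has an always active adversary circuit* if one of its circuits is corrupted all the time. **Theorem.** Let $P$ be a protocol and $I(P)$ an ideal protocol for it. "All environments" means all valid ones, including those whose application interacts directly with internal channel registers. 1. There is an absolute constant $\kappa$ such that for all $P$, $I(P)$: for every $\varepsilon$, if $P$ $\varepsilon$-securely realizes $I(P)$ in the original sense against all environments, it does so in the alternative sense; and there is a map $E\mapsto E'$ from valid environments to valid dummy environments, with $|E'|\le\kappa|E|$, such that for every $\varepsilon$, security in the alternative sense against all environments with bound $\varepsilon(E)$ implies security in the original sense against all environments with bound $\varepsilon(E')$, and so does security in the original sense against dummy environments with bound $\varepsilon(E)$. If $P$ has an always active adversary circuit, then the application in $E'$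 does not interact directly with internal channel registers, and the same implication holds from security in the original sense against all environments with this restriction. 2. (Unconditional scenario.) For every constant $\varepsilon$ the following are equivalent: $P$ $\varepsilon$-securely realizes $I(P)$ (a) in the original sense against all environments; (b) in the original sense against all dummy environments; (c) in the alternative sense against all environments. If $P$ has an always active adversary circuit, they are also equivalent to (d): in the original sense against all environments in which the application does not interact directly with internal channel registers. 3. (Computational scenario.) For families $(P_n)$, $(I_n)$ the computational versions of (a), (b), (c) are equivalent, and if every $P_n$ has an always active adversary circuit, also to that of (d). -/

import Mathlib

namespace QUC

/-! ### Registers, gates and their action -/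

/-- A register: a name, a kind (quantum or classical) and its largest basis value `top`
(the dimension, or the number of classical values, is `top + 1`). -/
structure Reg where
  name : ℕ
  quantum : Bool
  top : ℕ
deriving DecidableEq

/-- A (computational basis) value of every register. -/
abbrev Config : Type := (y : Reg) → Fin (y.top + 1)

/-- State vectors: finite superpositions of basis values. -/
abbrev State : Type := Config →₀ ℂ

/-- Values of the registers of a finite set. -/
abbrev Asg (t : Finset Reg) : Type := (y : t) → Fin (y.1.top + 1)

def Config.restrict (c : Config) (t : Finset Reg) : Asg t := fun y => c y.1

def Config.set (c : Config) (t : Finset Reg) (x : Asg t) : Config :=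
  fun y => if h : y ∈ t then x ⟨y, h⟩ else c y

/-- The elementary operations: a unitary on quantum registers, a permutation of the values of
classical registers, and the measurement of a quantum register `q` in the computational basis, whose
outcome is added to a classical register `k` with as many values as `q` (so it is stored in `k` when
`k` is fresh, that is, still zero). -/
inductive Op where
  | unitary (t : Finset Reg) (ht : ∀ y ∈ t, y.quantum = true)
      (U : Matrix.unitaryGroup (Asg t) ℂ)
  | classical (t : Finset Reg) (ht : ∀ y ∈ t, y.quantum = false) (p : Equiv.Perm (Asg t))
  | measure (q k : Reg) (hq : q.quantum = true) (hk : k.quantum = false) (h : q.top = k.top)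

/-- The registers that an operation acts on. -/
def Op.targets : Op → Finset Reg
  | .unitary t _ _ => t
  | .classical t _ _ => t
  | .measure q k _ _ _ => {q, k}

/-- The number of outcomes of an operation (one, unless it is a measurement). -/
def Op.numOut : Op → ℕ
  | .unitary _ _ _ => 1
  | .classical _ _ _ => 1
  | .measure q _ _ _ _ => q.top + 1

/-- The unnormalised state into which the basis state `c` is sent when the outcome is `x`. -/
noncomputable def Op.branch : Op → ℕ → Config → State
  | .unitary t _ U, _, c => ∑ a : Asg t, Finsupp.single (c.set t a) (U.1 a (c.restrict t))
  | .classical t _ p, _, c => Finsupp.single (c.set t (p (c.restrict t))) 1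
  | .measure q k _ _ _, x, c =>
      if (c q : ℕ) = x then
        Finsupp.single (Function.update c k (Fin.ofNat (k.top + 1) ((c k : ℕ) + (c q : ℕ)))) 1
      else 0

/-- A classically controlled gate: the operation `op` is executed exactly when every classical
control register `y` with `(y, b) ∈ guard` has the value `b`. -/
structure Gate where
  guard : Finset (Reg × ℕ)
  op : Op
  guard_classical : ∀ p ∈ guard, p.1.quantum = false
  guard_target : ∀ p ∈ guard, p.1 ∉ op.targets

/-- The registers that a gate accesses: its control registers and its targets. -/
def Gate.regs (g : Gate) : Finset Reg := g.guard.image Prod.fst ∪ g.op.targets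

/-- The controlled part of the gate is active. -/
def Gate.Active (g : Gate) (c : Config) : Prop := ∀ p ∈ g.guard, (c p.1 : ℕ) = p.2

/-- The gate does more to `y` than read a classical value. -/
def Gate.Modifies (g : Gate) (y : Reg) : Prop :=
  y ∈ g.op.targets ∧
    (y.quantum = true ∨ ∃ (c c' : Config) (x : ℕ), g.op.branch x c c' ≠ 0 ∧ c' y ≠ c y)

open Classical in
/-- The Kraus operator of a gate for the outcome `x`; an inactive gate is the identity (with the
single outcome `0`). -/
noncomputable def Gate.kraus (g : Gate) (x : ℕ) : State →ₗ[ℂ] State :=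
  Finsupp.linearCombination ℂ fun c : Config =>
    if g.Active c then g.op.branch x c else if x = 0 then Finsupp.single c 1 else 0

open Classical in
/-- The probability that register `Z` has the value `0` after the gates of a list have been executed,
one after the other, on the state `s`: the sum over all sequences of measurement outcomes. -/
noncomputable def probZero (Z : Reg) : List Gate → State → ℝ
  | [], s => s.sum fun c a => if (c Z : ℕ) = 0 then ‖a‖ ^ 2 else 0
  | g :: l, s => ∑ x ∈ Finset.range g.op.numOut, probZero Z l (g.kraus x s)

/-! ### Circuits -/

/-- A finite set of gates with a relation `lt` (`g` precedes `h`) that may depend on the initial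
value `v` of the registers. -/
structure Circuit where
  Idx : Type
  fin : Fintype Idx
  gate : Idx → Gate
  lt : Config → Idx → Idx → Prop

attribute [instance] Circuit.fin

def Circuit.size (C : Circuit) : ℕ := Fintype.card C.Idx

/-- `r` is a strict partial order. -/
def StrictOrder {ι : Type} (r : ι → ι → Prop) : Prop :=
  (∀ i, ¬ r i i) ∧ ∀ i j k, r i j → r j k → r i k

/-- For every initial value the gates are partially ordered, and two gates that access a common
register are ordered. -/
structure Circuit.IsCircuit (C : Circuit) : Prop where
  order : ∀ v, StrictOrder (C.lt v)
  comparable : ∀ v i j, i ≠ j → ¬ Disjoint (C.gate i).regs (C.gate j).regs →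
    C.lt v i j ∨ C.lt v j i

/-- A sequential execution: all gates, each one once, in an order that is compatible with `lt v`. -/
structure Circuit.IsExecution (C : Circuit) (v : Config) (l : List C.Idx) : Prop where
  nodup : l.Nodup
  all : ∀ i, i ∈ l
  compatible : l.Pairwise fun i j => ¬ C.lt v j i

/-- `Pr (Z = 0)` for an execution that starts with the initial value `v`. -/
noncomputable def Circuit.prob (C : Circuit) (Z : Reg) (v : Config) (l : List C.Idx) : ℝ :=
  probZero Z (l.map C.gate) (Finsupp.single v 1)

/-- `|Pr (Z_C = 0) - Pr (Z_D = 0)| ≤ ε` from the initial value `v`. (The probabilities of a circuit do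
not depend on the execution; the bound is asked for all of them.) -/
def Close (C D : Circuit) (Z : Reg) (v : Config) (ε : ℝ) : Prop :=
  ∀ l m, C.IsExecution v l → D.IsExecution v m → |C.prob Z v l - D.prob Z v m| ≤ ε

/-! ### Protocols -/

/-- What a channel-type lets a party do with a channel register: nothing, reading its classical
value, or anything. -/
inductive Access where
  | no
  | read
  | full

def Access.Permits : Access → Gate → Reg → Prop
  | .no, g, y => y ∉ g.regs
  | .read, g, y => ¬ (g.Modifies y) ∧ y.quantum = false
  | .full, _, _ => True

/-- The status of a module-role-circuit: not corruptible, corruptible with corruption register `C`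
(`0`: not corrupted, `1`: corrupted), or corrupted all the time (a passive auxiliary circuit on whose
behalf an eavesdropper acts). -/
inductive Status where
  | honest
  | corruptible (C : Reg)
  | corrupted

/-- The form of the gates of a module-role-circuit: off when the circuit is corrupted. -/
def Status.RoleGate : Status → Gate → Prop
  | .honest, _ => True
  | .corruptible C, g => (C, 0) ∈ g.guard
  | .corrupted, _ => False

/-- The form of the gates of the adversary circuit: on only when the circuit is corrupted. -/
def Status.AdvGate : Status → Gate → Prop
  | .honest, _ => False
  | .corruptible C, g => (C, 1) ∈ g.guard
  | .corrupted, _ => True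

/-- The controls of an adversary gate that has no other control. -/
def Status.advGuard : Status → Finset (Reg × ℕ)
  | .corruptible C => {(C, 1)}
  | _ => ∅

/-- A protocol: module-role-circuits (the gates are labelled by the circuit they belong to) with their
own registers `priv r`, internal channel registers `chan`, and input/output channel registers `io`
(shared with the application); activation registers are channel registers. The channel-types say what
may be done with a channel register in the name of the circuit `r` (`acc r`) and in nobody's name
(`pub`). The activation register of a communication gate is `act`. -/
structure Protocol where
  Role : Type
  roleFin : Fintype Role
  body : Circuit
  role : body.Idx → Role
  status : Role → Status
  priv : Role → Finset Reg
  chan : Finset Reg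
  io : Finset Reg
  acc : Role → Reg → Access
  pub : Reg → Access
  act : body.Idx → Option Reg

namespace Protocol

variable (P : Protocol)

/-- The corruption registers. -/
def corr : Set Reg := {y | ∃ r, P.status r = .corruptible y}

/-- The registers that only the protocol, the adversary and (for channels) the application see:
the private registers and the internal channel registers. -/
def internal : Set Reg := {y | (∃ r, y ∈ P.priv r) ∨ y ∈ P.chan}

def regs : Set Reg := {y | y ∈ P.internal ∨ y ∈ P.io ∨ y ∈ P.corr}

def size : ℕ := P.body.size

structure WellFormed : Prop where
  order : ∀ v, StrictOrder (P.body.lt v)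
  order_local : ∀ v w, (∀ y ∈ P.regs, v y = w y) → P.body.lt v = P.body.lt w
  /-- each module-role-circuit is a circuit; gates of distinct ones need not be ordered -/
  comparable : ∀ v i j, i ≠ j → P.role i = P.role j →
    ¬ Disjoint (P.body.gate i).regs (P.body.gate j).regs → P.body.lt v i j ∨ P.body.lt v j i
  role_gate : ∀ i, (P.status (P.role i)).RoleGate (P.body.gate i)
  access : ∀ i, ∀ y ∈ (P.body.gate i).regs,
    y ∈ P.priv (P.role i) ∨
    ((y ∈ P.chan ∨ y ∈ P.io) ∧ (P.acc (P.role i) y).Permits (P.body.gate i) y) ∨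
    (P.status (P.role i) = .corruptible y ∧ y ∉ (P.body.gate i).op.targets)
  /-- a gate that accesses a channel register has an activation register -/
  act_exists : ∀ i, ∀ y ∈ (P.body.gate i).regs, y ∈ P.chan ∨ y ∈ P.io → ∃ a, P.act i = some a
  /-- and is executed only if it has been woken up (`0`: SLEEP, `1`: WAKE-UP) -/
  act_guard : ∀ i a, P.act i = some a → (a, 1) ∈ (P.body.gate i).guard ∧ (a ∈ P.chan ∨ a ∈ P.io)
  act_inj : ∀ i j a, P.act i = some a → P.act j = some a → i = j
  /-- the activation registers of gates on an authenticated channel are authenticated -/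
  act_auth : ∀ i a, P.act i = some a → ∀ y ∈ (P.body.gate i).regs, y ∈ P.chan ∨ y ∈ P.io →
    P.pub y ≠ .full → P.pub a ≠ .full
  priv_priv : ∀ r s, r ≠ s → Disjoint (P.priv r) (P.priv s)
  priv_chan : ∀ r, Disjoint (P.priv r) P.chan
  priv_io : ∀ r, Disjoint (P.priv r) P.io
  chan_io : Disjoint P.chan P.io
  corr_fresh : ∀ y ∈ P.corr, y ∉ P.internal ∧ y ∉ P.io
  corr_bit : ∀ y ∈ P.corr, y.quantum = false ∧ y.top = 1
  corr_inj : ∀ r s y, P.status r = .corruptible y → P.status s = .corruptible y → r = s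

/-- There is an adversary circuit that is active all the time. -/
def HasEve : Prop := ∃ r, P.status r = .corrupted

end Protocol

/-- An ideal protocol for `P`: a protocol some of whose circuits `i` are the circuits `I(r)` that
correspond to circuits `r` of `P` (`ofRole i = some r`); the others (such as a trusted party) are not
corruptible and do not communicate with the application. -/
structure IdealProtocol (P : Protocol) extends Protocol where
  ofRole : Role → Option P.Role

structure IdealProtocol.WellFormed {P : Protocol} (I : IdealProtocol P) : Prop where
  protocol : I.toProtocol.WellFormed
  inj : ∀ i j r, I.ofRole i = some r → I.ofRole j = some r → i = j
  /-- `I(r)` is corrupted by the corruption register of `r` -/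
  status_some : ∀ i r, I.ofRole i = some r → I.status i = P.status r
  status_none : ∀ i, I.ofRole i = none → I.status i = .honest
  /-- `I(r)` uses the input/output channels of `r` as if it were `r` -/
  io_subset : I.io ⊆ P.io
  io_acc : ∀ i r, I.ofRole i = some r → ∀ y ∈ I.io, I.acc i y = P.acc r y
  io_none : ∀ i, I.ofRole i = none → ∀ y ∈ I.io, I.acc i y = .no
  io_pub : ∀ y ∈ I.io, I.pub y = P.pub y
  /-- and otherwise the ideal protocol has its own registers -/
  internal_fresh : ∀ y ∈ I.internal, y ∉ P.regs

/-- A well-formed pair of a protocol and an ideal protocol for it. -/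
def WellFormedPair (P : Protocol) (I : IdealProtocol P) : Prop := P.WellFormed ∧ I.WellFormed

/-! ### Environments -/

/-- An environment for `P`: an application and an adversary (the gate `a : Adv` belongs to the adversary
circuit `A(role a)`), the partial order `lt` of this circuit, and the partial order `ord` of the overall
setting, which also orders the gates of `P`. The registers `own` are those of the application that it
does not share with the adversary; the output register `Z` is one of them. All other registers that do
not belong to a protocol can be used by the adversary, and to communicate between the application and
the adversary. -/
structure Env (P : Protocol) where
  App : Type
  Adv : Type
  appFin : Fintype App
  advFin : Fintype Adv
  gate : App ⊕ Adv → Gate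
  lt : Config → App ⊕ Adv → App ⊕ Adv → Prop
  role : Adv → P.Role
  ord : Config → (App ⊕ Adv) ⊕ P.body.Idx → (App ⊕ Adv) ⊕ P.body.Idx → Prop
  own : Finset Reg
  Z : Reg

attribute [instance] Env.appFin Env.advFin

/-- Every gate other than `p` itself that sets the activation register of a communication gate `p`
precedes `p`. Here `emb` embeds the gates of `P` in those of the setting `C`. -/
def Activated (P : Protocol) (C : Circuit) (emb : P.body.Idx → C.Idx) : Prop :=
  ∀ v p a, P.act p = some a → ∀ j, j ≠ emb p → (C.gate j).Modifies a → C.lt v j (emb p)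

namespace Env

variable {P : Protocol} (E : Env P)

/-- The environment alone. -/
def circuit : Circuit where
  Idx := E.App ⊕ E.Adv
  fin := inferInstance
  gate := E.gate
  lt := E.lt

/-- The analysed side `App + Adv + P`. -/
def real : Circuit where
  Idx := (E.App ⊕ E.Adv) ⊕ P.body.Idx
  fin := inferInstance
  gate := Sum.elim E.gate P.body.gate
  lt := E.ord

def size : ℕ := E.circuit.size

/-- The registers of the environment that are not registers of `P`. -/
def regs : Set Reg := {y | (y ∈ E.own ∨ ∃ e, y ∈ (E.gate e).regs) ∧ y ∉ P.regs}

/-- The application uses its own registers, those shared with the adversary, the input/output channels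
and the corruption registers of `P`, and the internal channel registers in accordance with their
channel-type, but not the private registers of the circuits of `P`. -/
def AppAccess : Prop :=
  ∀ a : E.App, ∀ y ∈ (E.gate (.inl a)).regs,
    (∀ r, y ∉ P.priv r) ∧ (y ∈ P.chan → (P.pub y).Permits (E.gate (.inl a)) y)

/-- A gate of the adversary circuit `A(r)` is active only when `r` is corrupted; it uses the registers of
the environment, except `own`, those of `r`, and the channel registers in accordance with their
channel-type, where it can act in the name of `r`. It only reads corruption registers. -/
def AdvAccess : Prop :=
  ∀ a : E.Adv, (P.status (E.role a)).AdvGate (E.gate (.inr a)) ∧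
    ∀ y ∈ (E.gate (.inr a)).regs,
      y ∉ E.own ∧
      (∀ r, y ∈ P.priv r → r = E.role a) ∧
      (y ∈ P.chan ∨ y ∈ P.io →
        (P.acc (E.role a) y).Permits (E.gate (.inr a)) y ∨ (P.pub y).Permits (E.gate (.inr a)) y) ∧
      (y ∈ P.corr → y ∉ (E.gate (.inr a)).op.targets)

/-- A valid environment for `P`, whose register names do not clash with those of the ideal protocol. -/
structure Valid (I : IdealProtocol P) : Prop where
  isCircuit : E.circuit.IsCircuit
  isCircuit_real : E.real.IsCircuit
  ord_env : ∀ v e f, E.lt v e f → E.ord v (.inl e) (.inl f)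
  ord_protocol : ∀ v p q, P.body.lt v p q → E.ord v (.inr p) (.inr q)
  activated : Activated P E.real Sum.inr
  app : E.AppAccess
  adv : E.AdvAccess
  own_fresh : ∀ y ∈ E.own, y ∉ P.regs ∧ y ∉ I.internal
  ideal_fresh : ∀ e, ∀ y ∈ (E.gate e).regs, y ∉ I.internal
  Z_own : E.Z ∈ E.own
  Z_bit : E.Z.quantum = false ∧ E.Z.top = 1

/-- Initial values: arbitrary for the application's own registers, zero for all others. -/
def Initial (v : Config) : Prop := ∀ y, y ∉ E.own → v y = 0

/-- The application does not interact directly with the internal channel registers of `P`. -/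
def NoDirectChannel : Prop := ∀ a : E.App, ∀ y ∈ (E.gate (.inl a)).regs, y ∉ P.chan

end Env

/-- An operation that only forwards between registers of `P` and registers of the environment: these
are paired by `m`, and each pair is exchanged, or the classical value of the register of `P` is added
to, or subtracted from, that of the register of the environment (which copies it and erases the copy). -/
def Op.IsForwarding (P : Protocol) (o : Op) : Prop :=
  ∃ m : Reg → Reg,
    Function.Involutive m ∧
    (∀ y, y ∈ o.targets ↔ m y ≠ y) ∧
    (∀ y ∈ o.targets, (m y).quantum = y.quantum ∧ (m y).top = y.top ∧ (m y ∈ P.regs ↔ y ∉ P.regs)) ∧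
    ((∀ c : Config, ∃ c' : Config, o.branch 0 c = Finsupp.single c' 1 ∧
        ∀ y, (c' y : ℕ) = c (m y)) ∨
     ((∀ y ∈ o.targets, y.quantum = false) ∧ ∀ c : Config, ∃ c' : Config, o.branch 0 c = Finsupp.single c' 1 ∧
        ∀ y, (y ∈ o.targets → y ∉ P.regs → (c' y : ℕ) = ((c y : ℕ) + c (m y)) % (y.top + 1)) ∧
          (y ∉ o.targets ∨ y ∈ P.regs → c' y = c y)) ∨
     ((∀ y ∈ o.targets, y.quantum = false) ∧ ∀ c : Config, ∃ c' : Config, o.branch 0 c = Finsupp.single c' 1 ∧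
        ∀ y, (y ∈ o.targets → y ∉ P.regs → (c y : ℕ) = ((c' y : ℕ) + c (m y)) % (y.top + 1)) ∧
          (y ∉ o.targets ∨ y ∈ P.regs → c' y = c y)))

/-- The adversary is a dummy adversary: it only forwards between the application and the protocol. -/
def Env.IsDummy {P : Protocol} (E : Env P) : Prop :=
  ∀ a : E.Adv, (E.gate (.inr a)).guard = (P.status (E.role a)).advGuard ∧
    (E.gate (.inr a)).op.IsForwarding P

/-! ### The ideal side -/

/-- What a gate of a simulator or of an ideal adversary may do to `P` and `I(P)`. It only reads corruption
registers. The private and internal channel registers of `P`, which are not used by `I(P)`, are at its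
disposal. It uses the other registers of `P` and those of `I(P)` only in an adversary circuit of a
corrupted circuit `r`: input/output channels in accordance with their channel-type, and, if there is a
circuit `I(r)`, the registers of `I(r)` and the internal channels of `I(P)` in accordance with their
channel-type. -/
def IdealAccess {P : Protocol} (I : IdealProtocol P) (g : Gate) : Prop :=
  (∀ y ∈ g.op.targets, y ∉ P.corr) ∧
  ((∀ y ∈ g.regs, y ∉ P.io ∧ y ∉ I.internal) ∨
    ∃ r, (P.status r).AdvGate g ∧ ∀ y ∈ g.regs,
      (y ∈ P.io → (P.acc r y).Permits g y ∨ (P.pub y).Permits g y) ∧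
      (y ∈ I.internal → ∃ i, I.ofRole i = some r ∧
        (y ∈ I.priv i ∨ (y ∈ I.chan ∧ ((I.acc i y).Permits g y ∨ (I.pub y).Permits g y)))))

/-- A simulator against `E`, with the partial order of `App + Adv + S(P) + I(P)`. -/
structure Simulator {P : Protocol} (I : IdealProtocol P) (E : Env P) where
  Idx : Type
  fin : Fintype Idx
  gate : Idx → Gate
  ord : Config → ((E.App ⊕ E.Adv) ⊕ Idx) ⊕ I.body.Idx → ((E.App ⊕ E.Adv) ⊕ Idx) ⊕ I.body.Idx → Prop

attribute [instance] Simulator.fin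

namespace Simulator

variable {P : Protocol} {I : IdealProtocol P} {E : Env P} (S : Simulator I E)

/-- The ideal side `App + Adv + S(P) + I(P)`. -/
def ideal : Circuit where
  Idx := ((E.App ⊕ E.Adv) ⊕ S.Idx) ⊕ I.body.Idx
  fin := inferInstance
  gate := Sum.elim (Sum.elim E.gate S.gate) I.body.gate
  lt := S.ord

def size : ℕ := Fintype.card S.Idx

/-- The simulator interacts with the environment only through registers of the protocol. -/
structure Valid : Prop where
  isCircuit : S.ideal.IsCircuit
  ord_env : ∀ v e f, E.lt v e f → S.ord v (.inl (.inl e)) (.inl (.inl f))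
  ord_protocol : ∀ v p q, I.body.lt v p q → S.ord v (.inr p) (.inr q)
  activated : Activated I.toProtocol S.ideal Sum.inr
  access : ∀ s, IdealAccess I (S.gate s)
  env_fresh : ∀ s, ∀ y ∈ (S.gate s).regs, y ∉ E.regs

end Simulator

/-- An ideal adversary for the application of `E`, with the partial order of `App + Adv' + I(P)`. -/
structure IdealAdv {P : Protocol} (I : IdealProtocol P) (E : Env P) where
  Idx : Type
  fin : Fintype Idx
  gate : Idx → Gate
  ord : Config → (E.App ⊕ Idx) ⊕ I.body.Idx → (E.App ⊕ Idx) ⊕ I.body.Idx → Prop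

attribute [instance] IdealAdv.fin

namespace IdealAdv

variable {P : Protocol} {I : IdealProtocol P} {E : Env P} (A : IdealAdv I E)

/-- The ideal side `App + Adv' + I(P)` of the alternative definition. -/
def ideal : Circuit where
  Idx := (E.App ⊕ A.Idx) ⊕ I.body.Idx
  fin := inferInstance
  gate := Sum.elim (Sum.elim (fun a => E.gate (.inl a)) A.gate) I.body.gate
  lt := A.ord

def size : ℕ := Fintype.card A.Idx

structure Valid : Prop where
  isCircuit : A.ideal.IsCircuit
  ord_app : ∀ v a b, E.lt v (.inl a) (.inl b) → A.ord v (.inl (.inl a)) (.inl (.inl b))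
  ord_protocol : ∀ v p q, I.body.lt v p q → A.ord v (.inr p) (.inr q)
  activated : Activated I.toProtocol A.ideal Sum.inr
  access : ∀ s, IdealAccess I (A.gate s)
  own_fresh : ∀ s, ∀ y ∈ (A.gate s).regs, y ∉ E.own

end IdealAdv

/-! ### The security definitions -/

/-- Classes of environments: all, those with a dummy adversary, and those whose application does not
interact directly with channel registers. -/
def allEnv {P : Protocol} (_ : Env P) : Prop := True

def dummyEnv {P : Protocol} (E : Env P) : Prop := E.IsDummy

def noChannelEnv {P : Protocol} (E : Env P) : Prop := E.NoDirectChannel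

/-- `P` `ε`-securely realizes `I(P)` against the environments of a class: for every environment there is
a simulator such that the analysed side and the ideal side, with the same environment, are `ε`-close. -/
def Realizes {P : Protocol} (I : IdealProtocol P) (K : Env P → Prop) (ε : Env P → ℝ) : Prop :=
  ∀ E : Env P, E.Valid I → K E →
    ∃ S : Simulator I E, S.Valid ∧ ∀ v, E.Initial v → Close E.real S.ideal E.Z v (ε E)

/-- The alternative definition: for every application and adversary there is an ideal adversary such
that the analysed side and the ideal side, with the same application, are `ε`-close. -/
def AltRealizes {P : Protocol} (I : IdealProtocol P) (K : Env P → Prop) (ε : Env P → ℝ) : Prop :=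
  ∀ E : Env P, E.Valid I → K E →
    ∃ A : IdealAdv I E, A.Valid ∧ ∀ v, E.Initial v → Close E.real A.ideal E.Z v (ε E)

def PolyBounded (f : ℕ → ℕ) : Prop := ∃ p : Polynomial ℕ, ∀ n, f n ≤ p.eval n

/-- `ε n s` is negligible, where `n` is the security parameter and `s` the size of the environment. -/
def Negligible (ε : ℕ → ℕ → ℝ) : Prop :=
  ∀ f : ℕ → ℕ, PolyBounded f → ∀ q : Polynomial ℕ, (∀ n, 0 < q.eval n) →
    ∀ᶠ n in Filter.atTop, ε n (f n) ≤ 1 / ((q.eval n : ℕ) : ℝ)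

/-- `P n` computationally realizes `I n` (`n` is the security parameter). -/
def CompRealizes {P : ℕ → Protocol} (I : (n : ℕ) → IdealProtocol (P n))
    (K : (n : ℕ) → Env (P n) → Prop) : Prop :=
  PolyBounded (fun n => (P n).size) ∧ PolyBounded (fun n => (I n).size) ∧
  ∃ ε : ℕ → ℕ → ℝ, Negligible ε ∧
    ∀ E : (n : ℕ) → Env (P n), (∀ n, (E n).Valid (I n)) → (∀ n, K n (E n)) →
      PolyBounded (fun n => (E n).size) →
      ∃ S : (n : ℕ) → Simulator (I n) (E n), (∀ n, (S n).Valid) ∧ PolyBounded (fun n => (S n).size) ∧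
        ∀ n v, (E n).Initial v → Close (E n).real (S n).ideal (E n).Z v (ε n (E n).size)

/-- The alternative definition in the computational scenario. -/
def AltCompRealizes {P : ℕ → Protocol} (I : (n : ℕ) → IdealProtocol (P n))
    (K : (n : ℕ) → Env (P n) → Prop) : Prop :=
  PolyBounded (fun n => (P n).size) ∧ PolyBounded (fun n => (I n).size) ∧
  ∃ ε : ℕ → ℕ → ℝ, Negligible ε ∧
    ∀ E : (n : ℕ) → Env (P n), (∀ n, (E n).Valid (I n)) → (∀ n, K n (E n)) →
      PolyBounded (fun n => (E n).size) →
      ∃ A : (n : ℕ) → IdealAdv (I n) (E n), (∀ n, (A n).Valid) ∧ PolyBounded (fun n => (A n).size) ∧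
        ∀ n v, (E n).Initial v → Close (E n).real (A n).ideal (E n).Z v (ε n (E n).size)

end QUC

namespace QUC

/-! ### Renamings of registers -/

/-! From the original to the alternative definition there is only bookkeeping: the adversary and the
simulator together form an ideal adversary, and the two ideal sides are the same circuit up to
reassociation (`Simulator.toIdealAdv`).

The substance is the converse, which rests on one reduction, `Env.red`. All adversary gates of `E`
are handed to the application. There they may no longer act on the internal registers of `P` in the
name of a corrupted circuit, so each of them works on fresh copies reserved for this gate, and a
dummy adversary moves values to the copies before the gate and back after it. Quantum registers, and
classical ones that the gate modifies, are exchanged with their copies. Classical registers that it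
only reads are copied and the copies erased, because the channel-type may permit no more than
reading. A permutation of basis values is an operation on registers of one kind only, which gives
three moves before and three after, hence seven gates for one. The moves are controlled by the
corruption bit of the adversary circuit; when it is not set, the original gate is off as well. If
some circuit of `P` is corrupted all the time, the internal channels used by the application's own
gates are moved in the same way, in the name of that circuit.

On the analysed side the copies start at zero, and from such states a block of seven gates acts
exactly as the gate it replaces and leaves the copies at zero (`Slot.kraus_forward`). So every
execution of `App + Adv + P` is matched by one of the reduction with the same output probability
(`Env.exists_execution_red`).

On the ideal side, an ideal adversary against the reduction meets the renamed gates. The internal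
registers of `P` are free there, so a simulator may surround every gate of `E` with exchanges of
registers and copies; conjugation by the exchange is the renaming (`Slot.kraus_exchange`), on all
states. Thus `E` with this simulator behaves as the application of the reduction with the given
ideal adversary (`IdealAdv.Valid.toSimulator`, `IdealAdv.Valid.close_toSimulator`).

The equivalences follow by composing the two directions, since the reduced environment is dummy and,
with an always corrupted circuit, avoids direct use of the channels. In the computational case sizes
grow linearly, and `scaledError` turns the error into a function of the original size. -/

theorem Config.val_congr (c : Config) {y z : Reg} (h : y = z) : (c y : ℕ) = c z := by
  subst h; rfl

theorem Asg.val_congr {t : Finset Reg} (x : Asg t) {y z : t} (h : y = z) :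
    (x y : ℕ) = x z := by
  subst h; rfl

/-- An involution of the registers that preserves their kind and dimension. -/
structure Ren where
  toFun : Reg → Reg
  invol : ∀ y, toFun (toFun y) = y
  quantum : ∀ y, (toFun y).quantum = y.quantum
  top : ∀ y, (toFun y).top = y.top

instance : CoeFun Ren fun _ => Reg → Reg := ⟨Ren.toFun⟩

namespace Ren

variable (ρ : Ren)

/-- The action of a renaming on basis values. -/
def act (c : Config) : Config := fun y => Fin.cast (by rw [ρ.top]) (c (ρ y))

@[simp] theorem act_val (c : Config) (y : Reg) : (ρ.act c y : ℕ) = c (ρ y) := rfl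

@[simp] theorem act_act (c : Config) : ρ.act (ρ.act c) = c := by
  funext y
  apply Fin.ext
  simpa using c.val_congr (ρ.invol y)

theorem mem_image {t : Finset Reg} {y : Reg} : y ∈ t.image ρ ↔ ρ y ∈ t := by
  rw [Finset.mem_image]
  constructor
  · rintro ⟨z, hz, rfl⟩
    rwa [ρ.invol]
  · exact fun h => ⟨_, h, ρ.invol y⟩

/-- Renaming the registers of a partial assignment. -/
def asg (t : Finset Reg) : Asg (t.image ρ) ≃ Asg t where
  toFun x y := Fin.cast (by rw [ρ.top]) (x ⟨ρ y.1, Finset.mem_image_of_mem _ y.2⟩)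
  invFun x y := Fin.cast (by rw [ρ.top]) (x ⟨ρ y.1, ρ.mem_image.1 y.2⟩)
  left_inv x := by
    funext y
    apply Fin.ext
    have : (⟨ρ (ρ y.1), by rw [ρ.invol]; exact y.2⟩ : {z // z ∈ t.image ρ}) = y :=
      Subtype.ext (ρ.invol y.1)
    exact x.val_congr this
  right_inv x := by
    funext y
    apply Fin.ext
    have : (⟨ρ (ρ y.1), by rw [ρ.invol]; exact y.2⟩ : {z // z ∈ t}) = y :=
      Subtype.ext (ρ.invol y.1)
    exact x.val_congr this

theorem asg_restrict (t : Finset Reg) (c : Config) :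
    ρ.asg t ((ρ.act c).restrict (t.image ρ)) = c.restrict t := by
  funext y
  apply Fin.ext
  exact c.val_congr (ρ.invol y.1)

theorem act_set (t : Finset Reg) (c : Config) (x : Asg (t.image ρ)) :
    ρ.act (c.set t (ρ.asg t x)) = (ρ.act c).set (t.image ρ) x := by
  funext y
  apply Fin.ext
  by_cases h : ρ y ∈ t
  · have h' : y ∈ t.image ρ := ρ.mem_image.2 h
    have : (⟨ρ (ρ y), by rw [ρ.invol]; exact h'⟩ : {z // z ∈ t.image ρ}) = ⟨y, h'⟩ :=
      Subtype.ext (ρ.invol y)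
    simp only [act_val, Config.set, h, h', dif_pos, asg, Equiv.coe_fn_mk, Fin.val_cast]
    exact x.val_congr this
  · have h' : y ∉ t.image ρ := fun h' => h (ρ.mem_image.1 h')
    simp [Config.set, h, h']

end Ren

theorem submatrix_mem_unitaryGroup {m n : Type*} [Fintype m] [DecidableEq m] [Fintype n]
    [DecidableEq n] {U : Matrix n n ℂ} (hU : U ∈ Matrix.unitaryGroup n ℂ) (e f : m ≃ n) :
    U.submatrix e f ∈ Matrix.unitaryGroup m ℂ := by
  rw [Matrix.mem_unitaryGroup_iff] at hU ⊢
  rw [Matrix.star_eq_conjTranspose] at hU ⊢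
  rw [Matrix.conjTranspose_submatrix, Matrix.submatrix_mul_equiv, hU, Matrix.submatrix_one_equiv]

/-- An operation on the renamed registers. -/
def Op.rename (ρ : Ren) : Op → Op
  | .unitary t ht U => .unitary (t.image ρ)
      (fun y hy => by rw [← ρ.quantum]; exact ht _ (ρ.mem_image.1 hy))
      ⟨U.1.submatrix (ρ.asg t) (ρ.asg t), submatrix_mem_unitaryGroup U.2 _ _⟩
  | .classical t ht p => .classical (t.image ρ)
      (fun y hy => by rw [← ρ.quantum]; exact ht _ (ρ.mem_image.1 hy))
      ((ρ.asg t).trans (p.trans (ρ.asg t).symm))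
  | .measure q k hq hk h => .measure (ρ q) (ρ k) (by rw [ρ.quantum, hq]) (by rw [ρ.quantum, hk])
      (by rw [ρ.top, ρ.top, h])

namespace Op

theorem targets_rename (ρ : Ren) (o : Op) : (o.rename ρ).targets = o.targets.image ρ := by
  cases o <;> simp [rename, targets]

theorem numOut_rename (ρ : Ren) (o : Op) : (o.rename ρ).numOut = o.numOut := by
  cases o <;> simp [rename, numOut, ρ.top]

/-- Renaming an operation is conjugation by the permutation `ρ.act` of basis values. For a unitary
the sum over outputs is reindexed along `ρ.asg t`. -/
theorem branch_rename (ρ : Ren) (o : Op) (x : ℕ) (c : Config) :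
    (o.rename ρ).branch x (ρ.act c) = (o.branch x c).mapDomain ρ.act := by
  cases o with
  | unitary t ht U =>
    simp only [rename, branch, Finsupp.mapDomain_finsetSum, Finsupp.mapDomain_single]
    refine Fintype.sum_equiv (ρ.asg t) _ _ fun a => ?_
    rw [ρ.act_set, Matrix.submatrix_apply, ρ.asg_restrict]
  | classical t ht p =>
    simp only [rename, branch, Finsupp.mapDomain_single]
    rw [← (ρ.asg t).apply_symm_apply (p (c.restrict t)), ρ.act_set, Equiv.trans_apply,
      Equiv.trans_apply, ρ.asg_restrict]
  | measure q k hq hk h =>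
    have e : (ρ.act c (ρ q) : ℕ) = c q := c.val_congr (ρ.invol q)
    have e' : (ρ.act c (ρ k) : ℕ) = c k := c.val_congr (ρ.invol k)
    simp only [rename, branch, e, e']
    split_ifs
    · rw [Finsupp.mapDomain_single]
      congr 1
      funext y
      apply Fin.ext
      by_cases hy : y = ρ k
      · subst hy
        rw [Function.update_self, Ren.act_val]
        rw [Config.val_congr _ (ρ.invol k), Function.update_self]
        simp [Fin.ofNat, ρ.top]
      · have hy' : ρ y ≠ k := fun h' => hy (by rw [← h', ρ.invol])
        rw [Function.update_of_ne hy, Ren.act_val, Ren.act_val, Function.update_of_ne hy']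
    · simp

theorem branch_rename_apply (ρ : Ren) (o : Op) (x : ℕ) (c c' : Config) :
    (o.rename ρ).branch x c c' = o.branch x (ρ.act c) (ρ.act c') := by
  conv_lhs => rw [← ρ.act_act c, branch_rename, ← ρ.act_act c']
  exact Finsupp.mapDomain_apply (Function.LeftInverse.injective ρ.act_act) _ _

theorem branch_eq_of_notMem_targets {o : Op} {x : ℕ} {c c' : Config} (h : o.branch x c c' ≠ 0)
    {y : Reg} (hy : y ∉ o.targets) : c' y = c y := by
  cases o with
  | unitary t ht U =>
    simp only [branch, Finsupp.finsetSum_apply] at h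
    obtain ⟨a, -, ha⟩ := Finset.exists_ne_zero_of_sum_ne_zero h
    obtain ⟨rfl, -⟩ := Finsupp.single_apply_ne_zero.1 ha
    simp only [targets] at hy
    simp [Config.set, hy]
  | classical t ht p =>
    obtain ⟨rfl, -⟩ := Finsupp.single_apply_ne_zero.1 h
    simp only [targets] at hy
    simp [Config.set, hy]
  | measure q k hq hk hqk =>
    simp only [branch] at h
    split_ifs at h
    · obtain ⟨rfl, -⟩ := Finsupp.single_apply_ne_zero.1 h
      simp only [targets, Finset.mem_insert, Finset.mem_singleton, not_or] at hy
      rw [Function.update_of_ne hy.2]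
    · simp at h

/-- The action of an operation depends on its targets only, and changes nothing else. -/
theorem branch_eq_mapDomain (o : Op) (x : ℕ) {c d : Config} (h : ∀ y ∈ o.targets, d y = c y) :
    o.branch x d =
      (o.branch x c).mapDomain fun c' y => if y ∈ o.targets then c' y else d y := by
  cases o with
  | unitary t ht U =>
    have hr : d.restrict t = c.restrict t := funext fun y => h y.1 y.2
    simp only [branch, Finsupp.mapDomain_finsetSum, Finsupp.mapDomain_single, hr, targets]
    refine Finset.sum_congr rfl fun a _ => ?_
    congr 1
    funext y
    by_cases hy : y ∈ t <;> simp [Config.set, hy]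
  | classical t ht p =>
    have hr : d.restrict t = c.restrict t := funext fun y => h y.1 y.2
    simp only [branch, Finsupp.mapDomain_single, hr, targets]
    congr 1
    funext y
    by_cases hy : y ∈ t <;> simp [Config.set, hy]
  | measure q k hq hk hqk =>
    have h1 : d q = c q := h q (by simp [targets])
    have h2 : d k = c k := h k (by simp [targets])
    simp only [branch, h1, h2]
    split_ifs
    · rw [Finsupp.mapDomain_single]
      congr 1
      funext y
      by_cases hy : y = k
      · subst hy
        simp [targets]
      · rw [Function.update_of_ne hy, Function.update_of_ne hy]
        split_ifs with hy'
        · exact h y hy'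
        · rfl
    · simp

end Op

/-! ### Gates: renaming, support of the output, commutation with changes elsewhere -/

namespace Gate

/-- A gate on the renamed registers. -/
def rename (ρ : Ren) (g : Gate) : Gate where
  guard := g.guard.image fun p => (ρ p.1, p.2)
  op := g.op.rename ρ
  guard_classical := by
    intro p hp
    obtain ⟨q, hq, rfl⟩ := Finset.mem_image.1 hp
    rw [ρ.quantum]
    exact g.guard_classical q hq
  guard_target := by
    intro p hp
    obtain ⟨q, hq, rfl⟩ := Finset.mem_image.1 hp
    rw [Op.targets_rename, ρ.mem_image, ρ.invol]
    exact g.guard_target q hq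

variable (g : Gate)

theorem mem_regs {y : Reg} : y ∈ g.regs ↔ (∃ b, (y, b) ∈ g.guard) ∨ y ∈ g.op.targets := by
  simp [regs]

theorem mem_regs_rename (ρ : Ren) {y : Reg} : y ∈ (g.rename ρ).regs ↔ ρ y ∈ g.regs := by
  rw [mem_regs, mem_regs]
  simp only [rename, Op.targets_rename, ρ.mem_image, Finset.mem_image, Prod.exists,
    Prod.mk.injEq]
  refine or_congr ⟨?_, ?_⟩ Iff.rfl
  · rintro ⟨b, z, b', h, rfl, rfl⟩
    exact ⟨b', by rwa [ρ.invol]⟩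
  · rintro ⟨b, h⟩
    exact ⟨b, _, b, h, ρ.invol y, rfl⟩

theorem mem_guard_rename (ρ : Ren) {y : Reg} {b : ℕ} (h : (y, b) ∈ g.guard) :
    (ρ y, b) ∈ (g.rename ρ).guard :=
  Finset.mem_image.2 ⟨_, h, rfl⟩

theorem active_rename (ρ : Ren) (c : Config) : (g.rename ρ).Active (ρ.act c) ↔ g.Active c := by
  simp only [Active, rename, Finset.forall_mem_image, Ren.act_val]
  refine forall₂_congr fun p _ => ?_
  rw [c.val_congr (ρ.invol p.1)]

theorem Modifies.of_rename {ρ : Ren} {g : Gate} {y : Reg} (h : (g.rename ρ).Modifies y) :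
    g.Modifies (ρ y) := by
  obtain ⟨h1, h2⟩ := h
  refine ⟨ρ.mem_image.1 (Op.targets_rename ρ g.op ▸ h1), ?_⟩
  rw [ρ.quantum]
  refine h2.imp_right ?_
  rintro ⟨c, c', x, hb, hy⟩
  refine ⟨ρ.act c, ρ.act c', x, Op.branch_rename_apply ρ g.op x c c' ▸ hb, fun e => hy ?_⟩
  apply Fin.ext
  have := congrArg Fin.val e
  rwa [Ren.act_val, Ren.act_val, c.val_congr (ρ.invol y), c'.val_congr (ρ.invol y)] at this

theorem Modifies.rename (ρ : Ren) {g : Gate} {y : Reg} (h : g.Modifies y) :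
    (g.rename ρ).Modifies (ρ y) := by
  obtain ⟨h1, h2⟩ := h
  refine ⟨?_, ?_⟩
  · change ρ y ∈ (g.op.rename ρ).targets
    rw [Op.targets_rename, ρ.mem_image, ρ.invol]
    exact h1
  · rw [ρ.quantum]
    refine h2.imp_right ?_
    rintro ⟨c, c', x, hb, hy⟩
    refine ⟨ρ.act c, ρ.act c', x, ?_, fun e => hy ?_⟩
    · change (g.op.rename ρ).branch _ _ _ ≠ 0
      rwa [Op.branch_rename_apply, ρ.act_act, ρ.act_act]
    · apply Fin.ext
      have := congrArg Fin.val e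
      rwa [Ren.act_val, Ren.act_val, c.val_congr (ρ.invol y), c'.val_congr (ρ.invol y)] at this

theorem Modifies.mem_regs {g : Gate} {y : Reg} (h : g.Modifies y) : y ∈ g.regs :=
  (Gate.mem_regs g).2 (.inr h.1)

open Classical in
theorem kraus_single (x : ℕ) (c : Config) (a : ℂ) :
    g.kraus x (Finsupp.single c a) =
      a • if g.Active c then g.op.branch x c else if x = 0 then Finsupp.single c 1 else 0 := by
  rw [kraus, Finsupp.linearCombination_single]

/-- Two maps on states that agree on basis states agree. -/
theorem linearMap_eqOn {f f' : State →ₗ[ℂ] State} {s : State}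
    (h : ∀ c ∈ s.support, f (Finsupp.single c 1) = f' (Finsupp.single c 1)) : f s = f' s := by
  conv_lhs => rw [← Finsupp.sum_single s]
  conv_rhs => rw [← Finsupp.sum_single s]
  rw [Finsupp.sum, map_sum, map_sum]
  refine Finset.sum_congr rfl fun c hc => ?_
  rw [← mul_one (s c), ← smul_eq_mul, ← Finsupp.smul_single, map_smul, map_smul, h c hc]

/-- Since `ρ.act` is an involution, conjugation reads the same in both directions. Both halves of
the argument use it: moving values and moving the gate are interchangeable. -/
theorem kraus_rename (ρ : Ren) (x : ℕ) (s : State) :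
    (g.rename ρ).kraus x s = (g.kraus x (s.mapDomain ρ.act)).mapDomain ρ.act := by
  have := linearMap_eqOn (f := (g.rename ρ).kraus x) (s := s)
    (f' := Finsupp.lmapDomain ℂ ℂ ρ.act ∘ₗ g.kraus x ∘ₗ Finsupp.lmapDomain ℂ ℂ ρ.act)
  refine this fun c _ => ?_
  simp only [LinearMap.comp_apply, Finsupp.lmapDomain_apply, Finsupp.mapDomain_single,
    kraus_single, one_smul]
  have h1 := g.active_rename ρ (ρ.act c)
  have h2 : (g.rename ρ).op.branch x (ρ.act (ρ.act c)) = _ :=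
    Op.branch_rename ρ g.op x (ρ.act c)
  rw [ρ.act_act] at h1 h2
  by_cases h3 : g.Active (ρ.act c)
  · rw [if_pos h3, if_pos (h1.2 h3), h2]
  · rw [if_neg h3, if_neg (mt h1.1 h3)]
    split_ifs <;> simp

-- Invariants such as "the copies are zero" or "the corruption bit is set" pass through a gate by
-- this: every basis state in the output comes from one in the input with the same values of all
-- unmodified registers.
open Classical in
theorem kraus_support {x : ℕ} {s : State} {c' : Config} (h : c' ∈ (g.kraus x s).support) :
    ∃ c ∈ s.support, ∀ y, ¬ g.Modifies y → c' y = c y := by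
  rw [Finsupp.mem_support_iff, kraus, Finsupp.linearCombination_apply, Finsupp.sum,
    Finsupp.finsetSum_apply] at h
  obtain ⟨c, hc, hne⟩ := Finset.exists_ne_zero_of_sum_ne_zero h
  refine ⟨c, hc, fun y hy => ?_⟩
  rw [Finsupp.smul_apply, smul_eq_mul] at hne
  have hne := right_ne_zero_of_mul hne
  split_ifs at hne with h1 h2
  · by_cases hyt : y ∈ g.op.targets
    · by_contra hcy
      exact hy ⟨hyt, .inr ⟨c, c', x, hne, hcy⟩⟩
    · exact Op.branch_eq_of_notMem_targets hne hyt
  · obtain ⟨rfl, -⟩ := Finsupp.single_apply_ne_zero.1 hne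
    rfl
  · simp at hne

/-- A gate commutes with a change of registers which it does not access, if this depends only on
registers that it does not modify. -/
theorem kraus_mapDomain {D : Config → Config} (h1 : ∀ c, ∀ y ∈ g.regs, D c y = c y)
    (h2 : ∀ c c', (∀ y, ¬ g.Modifies y → c' y = c y) → ∀ y ∉ g.op.targets, D c' y = D c y)
    (x : ℕ) (s : State) :
    g.kraus x (s.mapDomain D) = (g.kraus x s).mapDomain D := by
  have := linearMap_eqOn (f := g.kraus x ∘ₗ Finsupp.lmapDomain ℂ ℂ D) (s := s)
    (f' := Finsupp.lmapDomain ℂ ℂ D ∘ₗ g.kraus x)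
  refine this fun c _ => ?_
  simp only [LinearMap.comp_apply, Finsupp.lmapDomain_apply, Finsupp.mapDomain_single,
    kraus_single, one_smul]
  have ha : g.Active (D c) ↔ g.Active c := by
    refine forall₂_congr fun p hp => ?_
    rw [h1 c p.1 ((g.mem_regs).2 (.inl ⟨p.2, hp⟩))]
  have hb : g.op.branch x (D c) = (g.op.branch x c).mapDomain D := by
    have ht : ∀ y ∈ g.op.targets, D c y = c y := fun y hy => h1 c y ((g.mem_regs).2 (.inr hy))
    rw [Op.branch_eq_mapDomain g.op x ht]
    refine Finsupp.mapDomain_congr fun c' hc' => ?_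
    funext y
    rw [Finsupp.mem_support_iff] at hc'
    split_ifs with hy
    · rw [h1 c' y ((g.mem_regs).2 (.inr hy))]
    · refine (h2 c c' (fun z hz => ?_) y hy).symm
      by_cases hzt : z ∈ g.op.targets
      · by_contra hcz
        exact hz ⟨hzt, .inr ⟨c, c', x, hc', hcz⟩⟩
      · exact Op.branch_eq_of_notMem_targets hc' hzt
  by_cases h3 : g.Active c
  · rw [if_pos h3, if_pos (ha.2 h3), hb]
  · rw [if_neg h3, if_neg (mt ha.1 h3)]
    split_ifs <;> simp

theorem kraus_of_active {f : Config → Config} (hf : ∀ c, g.op.branch 0 c = Finsupp.single (f c) 1)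
    {s : State} (hs : ∀ c ∈ s.support, g.Active c) : g.kraus 0 s = s.mapDomain f := by
  have := linearMap_eqOn (f := g.kraus 0) (s := s) (f' := Finsupp.lmapDomain ℂ ℂ f)
  refine this fun c hc => ?_
  simp [kraus_single, hs c hc, hf]

theorem kraus_of_not_active (x : ℕ) {s : State} (hs : ∀ c ∈ s.support, ¬ g.Active c) :
    g.kraus x s = if x = 0 then s else 0 := by
  have := linearMap_eqOn (f := g.kraus x) (s := s) (f' := if x = 0 then LinearMap.id else 0)
  rw [this]
  · split_ifs <;> simp
  · intro c hc
    rw [kraus_single, if_neg (hs c hc), one_smul]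
    split_ifs <;> rfl

end Gate

theorem probZero_cons_of_numOut (Z : Reg) {g : Gate} (hg : g.op.numOut = 1) (l : List Gate)
    (s : State) : probZero Z (g :: l) s = probZero Z l (g.kraus 0 s) := by
  simp [probZero, hg]

/-! ### Operations that permute the basis values -/

/-- A permutation of the values of the registers in `t`. -/
structure LocalPerm (t : Finset Reg) where
  toFun : Config → Config
  invFun : Config → Config
  left_inv : ∀ c, invFun (toFun c) = c
  right_inv : ∀ c, toFun (invFun c) = c
  frame : ∀ c, ∀ y ∉ t, toFun c y = c y
  loc : ∀ c d, (∀ y ∈ t, c y = d y) → ∀ y ∈ t, toFun c y = toFun d y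
  loc_inv : ∀ c d, (∀ y ∈ t, c y = d y) → ∀ y ∈ t, invFun c y = invFun d y

namespace LocalPerm

variable {t : Finset Reg} (f : LocalPerm t)

/-- Registers outside `t` are filled up with zeros; by `loc` and `loc_inv` the choice is immaterial.
-/
def asg : Equiv.Perm (Asg t) where
  toFun x := (f.toFun (Config.set (fun _ => 0) t x)).restrict t
  invFun x := (f.invFun (Config.set (fun _ => 0) t x)).restrict t
  left_inv x := by
    funext y
    have := f.loc_inv (Config.set (fun _ => 0) t
      ((f.toFun (Config.set (fun _ => 0) t x)).restrict t)) (f.toFun (Config.set (fun _ => 0) t x))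
      (fun y hy => by simp [Config.set, hy, Config.restrict]) y.1 y.2
    refine this.trans ?_
    rw [f.left_inv]
    simp [Config.set]
  right_inv x := by
    funext y
    have := f.loc (Config.set (fun _ => 0) t
      ((f.invFun (Config.set (fun _ => 0) t x)).restrict t)) (f.invFun (Config.set (fun _ => 0) t x))
      (fun y hy => by simp [Config.set, hy, Config.restrict]) y.1 y.2
    refine this.trans ?_
    rw [f.right_inv]
    simp [Config.set]

theorem set_asg (c : Config) : c.set t (f.asg (c.restrict t)) = f.toFun c := by
  funext y
  by_cases hy : y ∈ t
  · simp only [Config.set, hy, dif_pos, asg, Equiv.coe_fn_mk, Config.restrict]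
    exact f.loc _ _ (fun y hy => by simp [Config.set, hy, Config.restrict]) y hy
  · simp [Config.set, hy, f.frame c y hy]

/-- The operation on quantum (`b = true`) or classical registers that permutes the basis values. -/
def op (b : Bool) (ht : ∀ y ∈ t, y.quantum = b) : Op :=
  match b, ht with
  | true, ht => .unitary t ht
      -- The permutation matrix whose column `b` has its entry `1` in row `f.asg b`.
      ⟨(1 : Matrix (Asg t) (Asg t) ℂ).submatrix (Equiv.refl _) f.asg,
        submatrix_mem_unitaryGroup (one_mem _) _ _⟩
  | false, ht => .classical t ht f.asg

theorem targets_op (b : Bool) (ht : ∀ y ∈ t, y.quantum = b) : (f.op b ht).targets = t := by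
  cases b <;> rfl

theorem numOut_op (b : Bool) (ht : ∀ y ∈ t, y.quantum = b) : (f.op b ht).numOut = 1 := by
  cases b <;> rfl

theorem branch_op (b : Bool) (ht : ∀ y ∈ t, y.quantum = b) (x : ℕ) (c : Config) :
    (f.op b ht).branch x c = Finsupp.single (f.toFun c) 1 := by
  cases b
  · simp only [op, Op.branch]
    rw [f.set_asg]
  · have h : ∀ a : Asg t, ((1 : Matrix (Asg t) (Asg t) ℂ).submatrix (Equiv.refl _) f.asg) a
        (c.restrict t) = if a = f.asg (c.restrict t) then 1 else 0 := fun a => Matrix.one_apply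
    simp only [op, Op.branch, h]
    rw [Finset.sum_eq_single (f.asg (c.restrict t))]
    · rw [f.set_asg, if_pos rfl]
    · intro a _ ha
      rw [if_neg ha, Finsupp.single_zero]
    · simp

end LocalPerm

/-! ### Exchanging and copying registers -/

/-- Registers in `dom`, together with fresh copies, whose names are at least `bound` and depend on
the number `key` of the slot. -/
structure Slot where
  bound : ℕ
  key : ℕ
  dom : Finset Reg
  small : ∀ y ∈ dom, y.name < bound

namespace Slot

variable (σ : Slot)

/-- The fresh copy of a register. -/
def copy (y : Reg) : Reg := ⟨σ.bound + Nat.pair σ.key y.name, y.quantum, y.top⟩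

/-- The register whose fresh copy is `y` (if there is one). -/
def source (y : Reg) : Reg := ⟨(Nat.unpair (y.name - σ.bound)).2, y.quantum, y.top⟩

@[simp] theorem source_copy (y : Reg) : σ.source (σ.copy y) = y := by
  simp [source, copy]

theorem bound_le_copy (y : Reg) : σ.bound ≤ (σ.copy y).name := Nat.le_add_right _ _

theorem copy_injective : Function.Injective σ.copy := fun y z h => by
  rw [← σ.source_copy y, h, σ.source_copy]

theorem copy_notMem (y : Reg) : σ.copy y ∉ σ.dom := fun h =>
  (σ.small _ h).not_ge (σ.bound_le_copy y)

/-- The registers of the slot and their copies. -/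
def supp : Finset Reg := σ.dom ∪ σ.dom.image σ.copy

theorem mem_supp {y : Reg} : y ∈ σ.supp ↔ y ∈ σ.dom ∨ ∃ z ∈ σ.dom, σ.copy z = y := by
  simp [supp]

/-- The first two cases exclude each other, because names in `dom` are below `bound` and names of
copies are not. -/
def swap (y : Reg) : Reg :=
  if y ∈ σ.dom then σ.copy y else if y ∈ σ.dom.image σ.copy then σ.source y else y

theorem swap_of_mem {y : Reg} (h : y ∈ σ.dom) : σ.swap y = σ.copy y := if_pos h

theorem swap_copy {y : Reg} (h : y ∈ σ.dom) : σ.swap (σ.copy y) = y := by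
  rw [swap, if_neg (σ.copy_notMem y), if_pos (Finset.mem_image_of_mem _ h), source_copy]

theorem swap_of_notMem {y : Reg} (h : y ∉ σ.supp) : σ.swap y = y := by
  rw [mem_supp, not_or] at h
  rw [swap, if_neg h.1, if_neg]
  simpa using h.2

/-- The exchange of the registers of the slot with their copies. -/
def ren : Ren where
  toFun := σ.swap
  invol y := by
    by_cases h : y ∈ σ.supp
    · obtain h | ⟨z, hz, rfl⟩ := σ.mem_supp.1 h
      · rw [σ.swap_of_mem h, σ.swap_copy h]
      · rw [σ.swap_copy hz, σ.swap_of_mem hz]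
    · rw [σ.swap_of_notMem h, σ.swap_of_notMem h]
  quantum y := by
    rw [swap]; split_ifs <;> rfl
  top y := by
    rw [swap]; split_ifs <;> rfl

theorem ren_of_mem {y : Reg} (h : y ∈ σ.dom) : σ.ren y = σ.copy y := σ.swap_of_mem h

theorem ren_copy {y : Reg} (h : y ∈ σ.dom) : σ.ren (σ.copy y) = y := σ.swap_copy h

theorem ren_of_notMem {y : Reg} (h : y ∉ σ.supp) : σ.ren y = y := σ.swap_of_notMem h

theorem mem_supp_iff_ren {y : Reg} : y ∈ σ.supp ↔ σ.ren y ≠ y := by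
  refine ⟨fun h e => ?_, fun h => by_contra fun h' => h (σ.ren_of_notMem h')⟩
  obtain h | ⟨z, hz, rfl⟩ := σ.mem_supp.1 h
  · rw [σ.ren_of_mem h] at e
    exact σ.copy_notMem y (e.symm ▸ h)
  · rw [σ.ren_copy hz] at e
    exact σ.copy_notMem z (e ▸ hz)

theorem ren_mem_supp {y : Reg} (h : y ∈ σ.supp) : σ.ren y ∈ σ.supp := by
  rw [mem_supp_iff_ren] at h ⊢
  rw [σ.ren.invol]
  exact h.symm

theorem copy_mem_supp {y : Reg} (h : σ.copy y ∈ σ.supp) : y ∈ σ.dom := by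
  obtain h | ⟨z, h, e⟩ := σ.mem_supp.1 h
  · exact absurd h (σ.copy_notMem y)
  · exact σ.copy_injective e ▸ h

theorem mem_dom_of_mem_supp {y : Reg} (h : y ∈ σ.supp) (hy : y.name < σ.bound) : y ∈ σ.dom := by
  obtain h | ⟨z, h, rfl⟩ := σ.mem_supp.1 h
  · exact h
  · exact absurd (σ.bound_le_copy z) hy.not_ge

open Classical in
/-- A part of a slot. -/
noncomputable def restrict (p : Reg → Prop) : Slot where
  bound := σ.bound
  key := σ.key
  dom := σ.dom.filter p
  small y hy := σ.small y (Finset.mem_filter.1 hy).1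

theorem mem_restrict {p : Reg → Prop} {y : Reg} : y ∈ (σ.restrict p).dom ↔ y ∈ σ.dom ∧ p y := by
  simp [restrict]

theorem copy_restrict (p : Reg → Prop) : (σ.restrict p).copy = σ.copy := rfl

theorem supp_restrict_subset (p : Reg → Prop) : (σ.restrict p).supp ⊆ σ.supp := by
  intro y hy
  rw [mem_supp] at hy ⊢
  simp only [mem_restrict, copy_restrict] at hy
  exact hy.imp (·.1) fun ⟨z, h, e⟩ => ⟨z, h.1, e⟩

/-- The exchange of the values of the registers of a slot with those of their copies. -/
def exchange : LocalPerm σ.supp where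
  toFun := σ.ren.act
  invFun := σ.ren.act
  left_inv := σ.ren.act_act
  right_inv := σ.ren.act_act
  frame c y hy := Fin.ext (c.val_congr (σ.ren_of_notMem hy))
  loc c d h y hy := by
    apply Fin.ext
    rw [Ren.act_val, Ren.act_val, h _ (σ.ren_mem_supp hy)]
  loc_inv c d h y hy := by
    apply Fin.ext
    rw [Ren.act_val, Ren.act_val, h _ (σ.ren_mem_supp hy)]

/-- The values of the registers of the slot are added to those of their copies. -/
def add (c : Config) : Config := fun y =>
  if y ∈ σ.dom.image σ.copy then c y + σ.ren.act c y else c y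

/-- The values of the registers of the slot are subtracted from those of their copies. -/
def sub (c : Config) : Config := fun y =>
  if y ∈ σ.dom.image σ.copy then c y - σ.ren.act c y else c y

theorem mem_image_copy {y : Reg} : y ∈ σ.dom.image σ.copy ↔ y ∈ σ.supp ∧ y ∉ σ.dom := by
  rw [mem_supp, Finset.mem_image]
  constructor
  · rintro ⟨z, h, rfl⟩
    exact ⟨.inr ⟨z, h, rfl⟩, σ.copy_notMem z⟩
  · rintro ⟨h | h, h'⟩
    · exact absurd h h'
    · exact h

theorem ren_mem_dom {y : Reg} (h : y ∈ σ.dom.image σ.copy) : σ.ren y ∈ σ.dom := by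
  obtain ⟨z, hz, rfl⟩ := Finset.mem_image.1 h
  rwa [σ.ren_copy hz]

theorem add_of_notMem (c : Config) {y : Reg} (h : y ∉ σ.dom.image σ.copy) : σ.add c y = c y :=
  if_neg h

theorem sub_of_notMem (c : Config) {y : Reg} (h : y ∉ σ.dom.image σ.copy) : σ.sub c y = c y :=
  if_neg h

theorem notMem_image_of_mem {y : Reg} (h : y ∈ σ.dom) : y ∉ σ.dom.image σ.copy := fun h' =>
  (σ.mem_image_copy.1 h').2 h

/-- Adding the values of the registers of a slot to those of their copies. -/
def addition : LocalPerm σ.supp where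
  toFun := σ.add
  invFun := σ.sub
  left_inv c := by
    funext y
    by_cases h : y ∈ σ.dom.image σ.copy
    · have : σ.ren.act (σ.add c) y = σ.ren.act c y := by
        apply Fin.ext
        rw [Ren.act_val, Ren.act_val, σ.add_of_notMem _ (σ.notMem_image_of_mem (σ.ren_mem_dom h))]
      rw [sub, if_pos h, this, add, if_pos h, add_sub_cancel_right]
    · rw [σ.sub_of_notMem _ h, σ.add_of_notMem _ h]
  right_inv c := by
    funext y
    by_cases h : y ∈ σ.dom.image σ.copy
    · have : σ.ren.act (σ.sub c) y = σ.ren.act c y := by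
        apply Fin.ext
        rw [Ren.act_val, Ren.act_val, σ.sub_of_notMem _ (σ.notMem_image_of_mem (σ.ren_mem_dom h))]
      rw [add, if_pos h, this, sub, if_pos h, sub_add_cancel]
    · rw [σ.add_of_notMem _ h, σ.sub_of_notMem _ h]
  frame c y hy := σ.add_of_notMem c fun h => hy (σ.mem_image_copy.1 h).1
  loc c d h y hy := by
    have : σ.ren.act c y = σ.ren.act d y := by
      apply Fin.ext
      rw [Ren.act_val, Ren.act_val, h _ (σ.ren_mem_supp hy)]
    simp only [add, this, h y hy]
  loc_inv c d h y hy := by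
    have : σ.ren.act c y = σ.ren.act d y := by
      apply Fin.ext
      rw [Ren.act_val, Ren.act_val, h _ (σ.ren_mem_supp hy)]
    simp only [sub, this, h y hy]

/-- Subtracting the values of the registers of a slot from those of their copies. -/
def subtraction : LocalPerm σ.supp where
  toFun := σ.sub
  invFun := σ.add
  left_inv := σ.addition.right_inv
  right_inv := σ.addition.left_inv
  frame c _ hy := σ.sub_of_notMem c fun h => hy (σ.mem_image_copy.1 h).1
  loc := σ.addition.loc_inv
  loc_inv := σ.addition.loc

theorem quantum_of_mem_supp {b : Bool} (h : ∀ y ∈ σ.dom, y.quantum = b) :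
    ∀ y ∈ σ.supp, y.quantum = b := by
  intro y hy
  obtain hy | ⟨z, hz, rfl⟩ := σ.mem_supp.1 hy
  · exact h y hy
  · exact h z hz

/-- The exchange pairs registers of the protocol with other registers of the same kind. -/
theorem forwarding_pairing {P : Protocol} (h1 : ∀ y ∈ σ.dom, y ∈ P.regs)
    (h2 : ∀ y, σ.copy y ∉ P.regs) {y : Reg} (hy : y ∈ σ.supp) :
    (σ.ren y).quantum = y.quantum ∧ (σ.ren y).top = y.top ∧ (σ.ren y ∈ P.regs ↔ y ∉ P.regs) := by
  refine ⟨σ.ren.quantum y, σ.ren.top y, ?_⟩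
  obtain h | ⟨z, h, rfl⟩ := σ.mem_supp.1 hy
  · rw [σ.ren_of_mem h]
    exact iff_of_false (h2 y) (not_not_intro (h1 y h))
  · rw [σ.ren_copy h]
    exact iff_of_true (h1 z h) (h2 z)

theorem isForwarding_exchange {P : Protocol} (h1 : ∀ y ∈ σ.dom, y ∈ P.regs)
    (h2 : ∀ y, σ.copy y ∉ P.regs) (b : Bool) (hb : ∀ y ∈ σ.supp, y.quantum = b) :
    (σ.exchange.op b hb).IsForwarding P := by
  refine ⟨σ.ren, σ.ren.invol, fun y => ?_, fun y hy => ?_, .inl fun c => ?_⟩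
  · rw [LocalPerm.targets_op, mem_supp_iff_ren]
  · rw [LocalPerm.targets_op] at hy
    exact σ.forwarding_pairing h1 h2 hy
  · exact ⟨_, LocalPerm.branch_op _ _ _ _ _, fun _ => rfl⟩

theorem mem_image_of_notMem_regs {P : Protocol} (h1 : ∀ y ∈ σ.dom, y ∈ P.regs)
    {y : Reg} (hy : y ∈ σ.supp) (h : y ∉ P.regs) : y ∈ σ.dom.image σ.copy :=
  σ.mem_image_copy.2 ⟨hy, fun h' => h (h1 y h')⟩

theorem notMem_image_of_mem_regs {P : Protocol} (h2 : ∀ y, σ.copy y ∉ P.regs)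
    {y : Reg} (h : y ∉ σ.supp ∨ y ∈ P.regs) : y ∉ σ.dom.image σ.copy := by
  intro h'
  obtain h | h := h
  · exact h (σ.mem_image_copy.1 h').1
  · obtain ⟨z, -, rfl⟩ := Finset.mem_image.1 h'
    exact h2 z h

theorem isForwarding_addition {P : Protocol} (h1 : ∀ y ∈ σ.dom, y ∈ P.regs)
    (h2 : ∀ y, σ.copy y ∉ P.regs) (hb : ∀ y ∈ σ.supp, y.quantum = false) :
    (σ.addition.op false hb).IsForwarding P := by
  refine ⟨σ.ren, σ.ren.invol, fun y => ?_, fun y hy => ?_, .inr (.inl ⟨fun y hy => ?_, fun c => ?_⟩)⟩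
  · rw [LocalPerm.targets_op, mem_supp_iff_ren]
  · rw [LocalPerm.targets_op] at hy
    exact σ.forwarding_pairing h1 h2 hy
  · rw [LocalPerm.targets_op] at hy
    exact hb y hy
  · refine ⟨_, LocalPerm.branch_op _ _ _ _ _, fun y => ⟨fun hy h => ?_, fun h => ?_⟩⟩
    · rw [LocalPerm.targets_op] at hy
      change (σ.add c y : ℕ) = _
      rw [add, if_pos (σ.mem_image_of_notMem_regs h1 hy h), Fin.val_add]
      rfl
    · rw [LocalPerm.targets_op] at h
      exact σ.add_of_notMem c (σ.notMem_image_of_mem_regs h2 h)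

theorem isForwarding_subtraction {P : Protocol} (h1 : ∀ y ∈ σ.dom, y ∈ P.regs)
    (h2 : ∀ y, σ.copy y ∉ P.regs) (hb : ∀ y ∈ σ.supp, y.quantum = false) :
    (σ.subtraction.op false hb).IsForwarding P := by
  refine ⟨σ.ren, σ.ren.invol, fun y => ?_, fun y hy => ?_, .inr (.inr ⟨fun y hy => ?_, fun c => ?_⟩)⟩
  · rw [LocalPerm.targets_op, mem_supp_iff_ren]
  · rw [LocalPerm.targets_op] at hy
    exact σ.forwarding_pairing h1 h2 hy
  · rw [LocalPerm.targets_op] at hy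
    exact hb y hy
  · refine ⟨_, LocalPerm.branch_op _ _ _ _ _, fun y => ⟨fun hy h => ?_, fun h => ?_⟩⟩
    · rw [LocalPerm.targets_op] at hy
      change _ = ((σ.sub c y : ℕ) + σ.ren.act c y) % (y.top + 1)
      rw [← Fin.val_add, sub, if_pos (σ.mem_image_of_notMem_regs h1 hy h), sub_add_cancel]
    · rw [LocalPerm.targets_op] at h
      exact σ.sub_of_notMem c (σ.notMem_image_of_mem_regs h2 h)

/-- A register and its copy are either both moved or both fixed by a part of the slot, so exchanges
of different parts can be evaluated one pair at a time. -/
theorem ren_restrict_cases (p : Reg → Prop) {y : Reg} (hy : y ∈ σ.dom) :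
    (p y → (σ.restrict p).ren y = σ.copy y ∧ (σ.restrict p).ren (σ.copy y) = y) ∧
      (¬ p y → (σ.restrict p).ren y = y ∧ (σ.restrict p).ren (σ.copy y) = σ.copy y) := by
  refine ⟨fun hr => ?_, fun hr => ?_⟩
  · have : y ∈ (σ.restrict p).dom := σ.mem_restrict.2 ⟨hy, hr⟩
    exact ⟨(σ.restrict p).ren_of_mem this, (σ.restrict p).ren_copy this⟩
  · have : y ∉ (σ.restrict p).dom := fun h => hr (σ.mem_restrict.1 h).2
    exact ⟨(σ.restrict p).ren_of_notMem fun h =>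
        this ((σ.restrict p).mem_dom_of_mem_supp h (σ.small y hy)),
      (σ.restrict p).ren_of_notMem fun h => this ((σ.restrict p).copy_mem_supp h)⟩

/-- The exchange of a slot in two parts. -/
theorem act_restrict_act_restrict {p q : Reg → Prop} (h : ∀ y ∈ σ.dom, p y ↔ ¬ q y) (c : Config) :
    (σ.restrict p).ren.act ((σ.restrict q).ren.act c) = σ.ren.act c := by
  funext y
  apply Fin.ext
  simp only [Ren.act_val]
  apply c.val_congr
  by_cases hy : y ∈ σ.supp
  · obtain hy | ⟨z, hz, rfl⟩ := σ.mem_supp.1 hy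
    · rw [σ.ren_of_mem hy]
      by_cases hp : p y
      · rw [((σ.ren_restrict_cases p hy).1 hp).1, ((σ.ren_restrict_cases q hy).2 ((h y hy).1 hp)).2]
      · rw [((σ.ren_restrict_cases p hy).2 hp).1, ((σ.ren_restrict_cases q hy).1
            (by have := h y hy; tauto)).1]
    · rw [σ.ren_copy hz]
      by_cases hp : p z
      · rw [((σ.ren_restrict_cases p hz).1 hp).2, ((σ.ren_restrict_cases q hz).2 ((h z hz).1 hp)).1]
      · rw [((σ.ren_restrict_cases p hz).2 hp).2, ((σ.ren_restrict_cases q hz).1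
            (by have := h z hz; tauto)).2]
  · rw [σ.ren_of_notMem hy, (σ.restrict p).ren_of_notMem fun h => hy (σ.supp_restrict_subset p h),
      (σ.restrict q).ren_of_notMem fun h => hy (σ.supp_restrict_subset q h)]

end Slot

open Classical in
/-- An operation with given classical controls. -/
noncomputable def Gate.guarded (G : Finset (Reg × ℕ)) (o : Op) : Gate where
  guard := G.filter fun p => p.1.quantum = false ∧ p.1 ∉ o.targets
  op := o
  guard_classical _ hp := (Finset.mem_filter.1 hp).2.1
  guard_target _ hp := (Finset.mem_filter.1 hp).2.2

theorem Gate.guard_guarded {G : Finset (Reg × ℕ)} {o : Op}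
    (h : ∀ p ∈ G, p.1.quantum = false ∧ p.1 ∉ o.targets) : (Gate.guarded G o).guard = G := by
  classical
  exact Finset.filter_true_of_mem h

/-- All fresh registers have the value zero. -/
def Clean (N : ℕ) (c : Config) : Prop := ∀ y : Reg, N ≤ y.name → c y = 0

theorem Gate.clean_kraus {N : ℕ} {g : Gate} (hg : ∀ y ∈ g.regs, y.name < N) {x : ℕ} {s : State}
    (hs : ∀ c ∈ s.support, Clean N c) : ∀ c ∈ (g.kraus x s).support, Clean N c := by
  intro c' hc' y hy
  obtain ⟨c, hc, h⟩ := g.kraus_support hc'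
  rw [h y fun hm => (hg y hm.mem_regs).not_ge hy]
  exact hs c hc y hy

/-! ### The six forwarding steps around a gate, and conjugation by exchanges -/

namespace Slot

variable (σ : Slot) (g : Gate)

/-- The registers of a slot that are handled by the `k`-th forwarding step for `g`: quantum registers
and classical registers which `g` modifies are exchanged with their copies, before and after `g`; other
classical registers are copied, and the copies are erased. -/
noncomputable def part (k : Fin 6) : Slot :=
  match k with
  | 0 | 5 => σ.restrict fun y => y.quantum = true
  | 1 | 4 => σ.restrict fun y => y.quantum = false ∧ g.Modifies y
  | 2 | 3 => σ.restrict fun y => y.quantum = false ∧ ¬ g.Modifies y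

theorem part_dom_subset (k : Fin 6) : (σ.part g k).dom ⊆ σ.dom := by
  intro y hy
  fin_cases k <;> exact (σ.mem_restrict.1 hy).1

theorem part_copy (k : Fin 6) : (σ.part g k).copy = σ.copy := by
  fin_cases k <;> rfl

theorem part_bound (k : Fin 6) : (σ.part g k).bound = σ.bound := by
  fin_cases k <;> rfl

theorem quantum_restrict {p : Reg → Prop} {b : Bool} (h : ∀ y, p y → y.quantum = b) :
    ∀ y ∈ (σ.restrict p).supp, y.quantum = b :=
  quantum_of_mem_supp _ fun y hy => h y (σ.mem_restrict.1 hy).2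

/-- The `k`-th forwarding step for `g` as a permutation of the basis values. -/
noncomputable def step (k : Fin 6) : LocalPerm (σ.part g k).supp :=
  match k with
  | 0 => (σ.part g 0).exchange
  | 1 => (σ.part g 1).exchange
  | 2 => (σ.part g 2).addition
  | 3 => (σ.part g 3).subtraction
  | 4 => (σ.part g 4).exchange
  | 5 => (σ.part g 5).exchange

/-- The kind of the registers in the `k`-th forwarding step. -/
def stepQuantum (k : Fin 6) : Bool :=
  match k with
  | 0 | 5 => true
  | 1 | 2 | 3 | 4 => false

theorem quantum_part (k : Fin 6) : ∀ y ∈ (σ.part g k).supp, y.quantum = stepQuantum k := by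
  fin_cases k
  · exact σ.quantum_restrict fun _ h => h
  · exact σ.quantum_restrict fun _ h => h.1
  · exact σ.quantum_restrict fun _ h => h.1
  · exact σ.quantum_restrict fun _ h => h.1
  · exact σ.quantum_restrict fun _ h => h.1
  · exact σ.quantum_restrict fun _ h => h

/-- The `k`-th forwarding step for `g`. -/
noncomputable def forward (k : Fin 6) : Op :=
  (σ.step g k).op (stepQuantum k) (σ.quantum_part g k)

/-- The action of the `k`-th forwarding step on basis values. -/
noncomputable def forwardMap (k : Fin 6) : Config → Config := (σ.step g k).toFun

theorem targets_forward (k : Fin 6) : (σ.forward g k).targets = (σ.part g k).supp :=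
  LocalPerm.targets_op _ _ _

theorem numOut_forward (k : Fin 6) : (σ.forward g k).numOut = 1 :=
  LocalPerm.numOut_op _ _ _

theorem branch_forward (k : Fin 6) (x : ℕ) (c : Config) :
    (σ.forward g k).branch x c = Finsupp.single (σ.forwardMap g k c) 1 :=
  LocalPerm.branch_op _ _ _ _ _

theorem forwardMap_of_notMem (k : Fin 6) (c : Config) {y : Reg} (h : y ∉ (σ.part g k).supp) :
    σ.forwardMap g k c y = c y :=
  (σ.step g k).frame c y h

theorem isForwarding_forward {P : Protocol} (h1 : ∀ y ∈ σ.dom, y ∈ P.regs)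
    (h2 : ∀ y, σ.copy y ∉ P.regs) (k : Fin 6) : (σ.forward g k).IsForwarding P := by
  have h1' : ∀ k, ∀ y ∈ (σ.part g k).dom, y ∈ P.regs := fun k y hy =>
    h1 y (σ.part_dom_subset g k hy)
  have h2' : ∀ k, ∀ y, (σ.part g k).copy y ∉ P.regs := fun k y => by
    rw [part_copy]; exact h2 y
  fin_cases k
  · exact isForwarding_exchange _ (h1' 0) (h2' 0) _ _
  · exact isForwarding_exchange _ (h1' 1) (h2' 1) _ _
  · exact isForwarding_addition _ (h1' 2) (h2' 2) _
  · exact isForwarding_subtraction _ (h1' 3) (h2' 3) _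
  · exact isForwarding_exchange _ (h1' 4) (h2' 4) _ _
  · exact isForwarding_exchange _ (h1' 5) (h2' 5) _ _

/-- The forwarding steps modify only those given registers that `g` modifies. -/
theorem modifies_of_forward {g : Gate} (hσ : ∀ y ∈ σ.dom, y ∈ g.regs) {G : Finset (Reg × ℕ)}
    {k : Fin 6} {y : Reg} (hy : y.name < σ.bound)
    (h : (Gate.guarded G (σ.forward g k)).Modifies y) : g.Modifies y := by
  obtain ⟨h1, h2⟩ := h
  change y ∈ (σ.forward g k).targets at h1
  rw [targets_forward] at h1
  have hd := (σ.part g k).mem_dom_of_mem_supp h1 (by rwa [part_bound])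
  have hqu : y.quantum = true → g.Modifies y := fun hq => by
    obtain ⟨b, hb⟩ | ht := g.mem_regs.1 (hσ y (σ.part_dom_subset g k hd))
    -- Controls are classical, so a quantum register of `g` is a target, and quantum targets count
    -- as modified.
    · exact absurd ((g.guard_classical _ hb).symm.trans hq) (by decide)
    · exact ⟨ht, .inl hq⟩
  obtain h2 | ⟨c, c', x, hb, hne⟩ := h2
  · exact hqu h2
  change (σ.forward g k).branch x c c' ≠ 0 at hb
  rw [branch_forward] at hb
  obtain ⟨rfl, -⟩ := Finsupp.single_apply_ne_zero.1 hb
  fin_cases k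
  · exact hqu (σ.mem_restrict.1 hd).2
  · exact (σ.mem_restrict.1 hd).2.2
  -- Copying and erasing change the copy alone; the register that is read keeps its value.
  · exact absurd ((σ.part g 2).add_of_notMem c ((σ.part g 2).notMem_image_of_mem hd)) hne
  · exact absurd ((σ.part g 3).sub_of_notMem c ((σ.part g 3).notMem_image_of_mem hd)) hne
  · exact (σ.mem_restrict.1 hd).2.2
  · exact hqu (σ.mem_restrict.1 hd).2

theorem mem_image_copy_restrict (p : Reg → Prop) {y : Reg} :
    σ.copy y ∈ (σ.restrict p).dom.image (σ.restrict p).copy ↔ y ∈ σ.dom ∧ p y := by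
  rw [copy_restrict, Finset.mem_image]
  constructor
  · rintro ⟨z, hz, e⟩
    rw [σ.copy_injective e] at hz
    exact σ.mem_restrict.1 hz
  · exact fun h => ⟨y, σ.mem_restrict.2 h, rfl⟩

theorem notMem_image_copy_restrict (p : Reg → Prop) {y : Reg} (h : y ∈ σ.dom ∨ y ∉ σ.supp) :
    y ∉ (σ.restrict p).dom.image (σ.restrict p).copy := by
  intro h'
  obtain ⟨h1, h2⟩ := (σ.restrict p).mem_image_copy.1 h'
  obtain h | h := h
  · exact h2 ((σ.restrict p).mem_dom_of_mem_supp h1 (σ.small y h))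
  · exact h (σ.supp_restrict_subset p h1)

/-- After the first three forwarding steps, exchanging all registers of the slot with their copies
only has the effect of the third one. -/
theorem act_forwardMap {c : Config} (hc : Clean σ.bound c) :
    σ.ren.act (σ.forwardMap g 2 (σ.forwardMap g 1 (σ.forwardMap g 0 c))) =
      σ.forwardMap g 2 c := by
  funext y
  apply Fin.ext
  have hQ := fun z (hz : z ∈ σ.dom) => σ.ren_restrict_cases (fun y => y.quantum = true) hz
  have hK := fun z (hz : z ∈ σ.dom) =>
    σ.ren_restrict_cases (fun y => y.quantum = false ∧ g.Modifies y) hz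
  have hR := fun z (hz : z ∈ σ.dom) =>
    σ.ren_restrict_cases (fun y => y.quantum = false ∧ ¬ g.Modifies y) hz
  have h0 : ∀ z, (c (σ.copy z) : ℕ) = 0 := fun z => by rw [hc _ (σ.bound_le_copy z)]; rfl
  rw [Ren.act_val]
  by_cases hy : y ∈ σ.supp
  · obtain hy | ⟨z, hz, rfl⟩ := σ.mem_supp.1 hy
    · rw [Config.val_congr _ (σ.ren_of_mem hy)]
      change ((σ.restrict _).add _ _ : ℕ) = (σ.restrict _).add _ _
      rw [(σ.restrict _).add_of_notMem c (σ.notMem_image_copy_restrict _ (.inl hy)), add]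
      -- At `y` one sees the value that its copy has received. For a register that is only read this
      -- is `0 + c y`, as the copy was clean; otherwise the exchange has brought `c y` there.
      by_cases hr : y.quantum = false ∧ ¬ g.Modifies y
      · rw [if_pos ((σ.mem_image_copy_restrict _).2 ⟨hy, hr⟩), Fin.val_add, Ren.act_val,
          Config.val_congr _ ((hR y hy).1 hr).2]
        change (((σ.restrict _).ren.act ((σ.restrict _).ren.act c) (σ.copy y) : ℕ) +
          (σ.restrict _).ren.act ((σ.restrict _).ren.act c) y) % _ = _
        simp only [Ren.act_val]
        have e1 : ¬ (y.quantum = false ∧ g.Modifies y) := fun h => hr.2 h.2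
        have e2 : ¬ (y.quantum = true) := by simp [hr.1]
        rw [Config.val_congr _ (congrArg _ ((hK y hy).2 e1).1),
          Config.val_congr _ (congrArg _ ((hK y hy).2 e1).2),
          Config.val_congr _ ((hQ y hy).2 e2).1, Config.val_congr _ ((hQ y hy).2 e2).2, h0,
          Nat.zero_add]
        exact Nat.mod_eq_of_lt (c y).2
      · rw [if_neg fun h => hr ((σ.mem_image_copy_restrict _).1 h).2]
        change ((σ.restrict _).ren.act ((σ.restrict _).ren.act c) (σ.copy y) : ℕ) = _
        simp only [Ren.act_val]
        by_cases hq : y.quantum = true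
        · have e1 : ¬ (y.quantum = false ∧ g.Modifies y) := by simp [hq]
          rw [Config.val_congr _ (congrArg _ ((hK y hy).2 e1).2),
            Config.val_congr _ ((hQ y hy).1 hq).2]
        · have e1 : y.quantum = false ∧ g.Modifies y := by
            rw [Bool.not_eq_true] at hq
            exact ⟨hq, by tauto⟩
          rw [Config.val_congr _ (congrArg _ ((hK y hy).1 e1).2),
            Config.val_congr _ ((hQ y hy).2 hq).1]
    · rw [Config.val_congr _ (σ.ren_copy hz)]
      change ((σ.restrict _).add _ _ : ℕ) = (σ.restrict _).add _ _
      rw [(σ.restrict _).add_of_notMem _ (σ.notMem_image_copy_restrict _ (.inl hz)), add]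
      change ((σ.restrict _).ren.act ((σ.restrict _).ren.act c) z : ℕ) = _
      simp only [Ren.act_val]
      -- At the copy of `z` one sees what is left in `z`. A register that is only read still holds
      -- `c z`, which agrees with `0 + c z` on the right; in the other cases `z` holds the zero of
      -- its clean copy.
      by_cases hr : z.quantum = false ∧ ¬ g.Modifies z
      · have e1 : ¬ (z.quantum = false ∧ g.Modifies z) := fun h => hr.2 h.2
        have e2 : ¬ (z.quantum = true) := by simp [hr.1]
        rw [if_pos ((σ.mem_image_copy_restrict _).2 ⟨hz, hr⟩), Fin.val_add, Ren.act_val,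
          Config.val_congr _ ((hR z hz).1 hr).2, h0, Nat.zero_add,
          Config.val_congr _ (congrArg _ ((hK z hz).2 e1).1),
          Config.val_congr _ ((hQ z hz).2 e2).1]
        exact (Nat.mod_eq_of_lt (c z).2).symm
      · rw [if_neg fun h => hr ((σ.mem_image_copy_restrict _).1 h).2, h0]
        by_cases hq : z.quantum = true
        · have e1 : ¬ (z.quantum = false ∧ g.Modifies z) := by simp [hq]
          rw [Config.val_congr _ (congrArg _ ((hK z hz).2 e1).1),
            Config.val_congr _ ((hQ z hz).1 hq).1, h0]
        · have e1 : z.quantum = false ∧ g.Modifies z := by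
            rw [Bool.not_eq_true] at hq
            exact ⟨hq, by tauto⟩
          rw [Config.val_congr _ (congrArg _ ((hK z hz).1 e1).1),
            Config.val_congr _ ((hQ z hz).2 hq).2, h0]
  · have hn : ∀ k, y ∉ (σ.part g k).supp := fun k h =>
      hy (by fin_cases k <;> exact σ.supp_restrict_subset _ h)
    rw [Config.val_congr _ (σ.ren_of_notMem hy), forwardMap_of_notMem _ _ _ _ (hn _),
      forwardMap_of_notMem _ _ _ _ (hn _), forwardMap_of_notMem _ _ _ _ (hn _),
      forwardMap_of_notMem _ _ _ _ (hn _)]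

/-- Steps 3, 4, 5 undo steps 2, 1, 0 in this order. Clean copies are not needed here, only in
`act_forwardMap`. -/
theorem forwardMap_inverse (c : Config) :
    σ.forwardMap g 5 (σ.forwardMap g 4 (σ.forwardMap g 3
      (σ.forwardMap g 2 (σ.forwardMap g 1 (σ.forwardMap g 0 c))))) = c := by
  have h1 := (σ.part g 2).addition.left_inv (σ.forwardMap g 1 (σ.forwardMap g 0 c))
  change σ.forwardMap g 3 (σ.forwardMap g 2 (σ.forwardMap g 1 (σ.forwardMap g 0 c))) = _ at h1
  rw [h1]
  have h2 := (σ.part g 1).ren.act_act (σ.forwardMap g 0 c)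
  change σ.forwardMap g 4 (σ.forwardMap g 1 (σ.forwardMap g 0 c)) = _ at h2
  rw [h2]
  exact (σ.part g 0).ren.act_act c

variable {σ g}

/-- On clean states, the renamed gate between the forwarding steps acts as the original gate. -/
theorem kraus_forward {G : Finset (Reg × ℕ)} (hG : G ⊆ g.guard) (hGσ : ∀ p ∈ G, p.1 ∉ σ.dom)
    (hg : ∀ y ∈ g.regs, y.name < σ.bound) {s : State} (hs : ∀ c ∈ s.support, Clean σ.bound c)
    (x : ℕ) :
    (Gate.guarded G (σ.forward g 5)).kraus 0 ((Gate.guarded G (σ.forward g 4)).kraus 0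
      ((Gate.guarded G (σ.forward g 3)).kraus 0 ((g.rename σ.ren).kraus x
        ((Gate.guarded G (σ.forward g 2)).kraus 0 ((Gate.guarded G (σ.forward g 1)).kraus 0
          ((Gate.guarded G (σ.forward g 0)).kraus 0 s)))))) = g.kraus x s := by
  let K : Fin 6 → State →ₗ[ℂ] State := fun k => (Gate.guarded G (σ.forward g k)).kraus 0
  -- Both sides are linear, so basis states in the support suffice; this takes care of
  -- superpositions and entanglement.
  have := Gate.linearMap_eqOn (s := s) (f' := g.kraus x)
    (f := K 5 ∘ₗ K 4 ∘ₗ K 3 ∘ₗ (g.rename σ.ren).kraus x ∘ₗ K 2 ∘ₗ K 1 ∘ₗ K 0)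
  refine this fun c hc => ?_
  have hclean := hs c hc
  have hsmall : ∀ p ∈ G, p.1.name < σ.bound := fun p hp =>
    hg _ (g.mem_regs.2 (.inl ⟨p.2, hG hp⟩))
  have hnot : ∀ k, ∀ p ∈ G, p.1 ∉ (σ.part g k).supp := fun k p hp h =>
    hGσ p hp (σ.part_dom_subset g k ((σ.part g k).mem_dom_of_mem_supp h
      (by rw [part_bound]; exact hsmall p hp)))
  have hguard : ∀ k, (Gate.guarded G (σ.forward g k)).guard = G := fun k =>
    Gate.guard_guarded fun p hp => ⟨g.guard_classical p (hG hp), by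
      rw [targets_forward]; exact hnot k p hp⟩
  have hact : ∀ k c, (Gate.guarded G (σ.forward g k)).Active c ↔ ∀ p ∈ G, (c p.1 : ℕ) = p.2 := by
    intro k c
    rw [Gate.Active, hguard]
  simp only [LinearMap.comp_apply]
  by_cases hA : ∀ p ∈ G, (c p.1 : ℕ) = p.2
  · have hmap : ∀ k c, (∀ p ∈ G, (c p.1 : ℕ) = p.2) →
        ∀ p ∈ G, (σ.forwardMap g k c p.1 : ℕ) = p.2 := fun k c h p hp => by
      rw [forwardMap_of_notMem _ _ _ _ (hnot k p hp)]
      exact h p hp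
    have hK : ∀ k (s : State), (∀ c ∈ s.support, ∀ p ∈ G, (c p.1 : ℕ) = p.2) →
        K k s = s.mapDomain (σ.forwardMap g k) := fun k s hs =>
      Gate.kraus_of_active _ (σ.branch_forward g k 0) fun c hc => (hact k c).2 (hs c hc)
    have hK1 : ∀ k c, (∀ p ∈ G, (c p.1 : ℕ) = p.2) →
        K k (Finsupp.single c 1) = Finsupp.single (σ.forwardMap g k c) 1 := fun k c h => by
      rw [hK k _ _, Finsupp.mapDomain_single]
      intro c' hc'
      obtain rfl := Finset.mem_singleton.1 (Finsupp.support_single_subset hc')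
      exact h
    -- Renaming is conjugation by the full exchange. Applied to the forwarded basis state, the inner
    -- exchange leaves only the copying step, by `act_forwardMap`, and this commutes with `g`.
    rw [hK1 0 c hA, hK1 1 _ (hmap 0 _ hA), hK1 2 _ (hmap 1 _ (hmap 0 _ hA)), Gate.kraus_rename g,
      Finsupp.mapDomain_single, σ.act_forwardMap g hclean, ← Finsupp.mapDomain_single,
      Gate.kraus_mapDomain g]
    · set w := g.kraus x (Finsupp.single c 1)
      have hwc : ∀ c' ∈ w.support, Clean σ.bound c' ∧ ∀ p ∈ G, (c' p.1 : ℕ) = p.2 := by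
        intro c' hc'
        refine ⟨Gate.clean_kraus hg (fun c₀ hc₀ => ?_) c' hc', fun p hp => ?_⟩
        · obtain rfl := Finset.mem_singleton.1 (Finsupp.support_single_subset hc₀)
          exact hclean
        · obtain ⟨c₀, hc₀, h⟩ := g.kraus_support hc'
          obtain rfl := Finset.mem_singleton.1 (Finsupp.support_single_subset hc₀)
          rw [h _ fun hm => g.guard_target p (hG hp) hm.1]
          exact hA p hp
      -- The outer exchange turns the copying step back into all three forward moves, now on the
      -- output of `g`. This uses `act_forwardMap` again, as the output is still clean.
      have h1 : (w.mapDomain (σ.forwardMap g 2)).mapDomain σ.ren.act =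
          w.mapDomain fun c => σ.forwardMap g 2 (σ.forwardMap g 1 (σ.forwardMap g 0 c)) := by
        rw [← Finsupp.mapDomain_comp]
        refine Finsupp.mapDomain_congr fun c' hc' => ?_
        rw [Function.comp_apply, ← σ.act_forwardMap g (hwc c' hc').1, Ren.act_act]
      rw [h1]
      have hsupp : ∀ f : Config → Config,
          (∀ c, (∀ p ∈ G, (c p.1 : ℕ) = p.2) → ∀ p ∈ G, (f c p.1 : ℕ) = p.2) →
          ∀ c ∈ (w.mapDomain f).support, ∀ p ∈ G, (c p.1 : ℕ) = p.2 := by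
        classical
        intro f hf c' hc'
        obtain ⟨c₀, hc₀, rfl⟩ := Finset.mem_image.1 (Finsupp.mapDomain_support hc')
        exact hf c₀ (hwc c₀ hc₀).2
      rw [hK 3, ← Finsupp.mapDomain_comp, hK 4, ← Finsupp.mapDomain_comp, hK 5,
        ← Finsupp.mapDomain_comp]
      · conv_rhs => rw [← Finsupp.mapDomain_id (v := w)]
        exact Finsupp.mapDomain_congr fun c' _ => σ.forwardMap_inverse g c'
      · exact hsupp _ fun c h => hmap 4 _ (hmap 3 _ (hmap 2 _ (hmap 1 _ (hmap 0 _ h))))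
      · exact hsupp _ fun c h => hmap 3 _ (hmap 2 _ (hmap 1 _ (hmap 0 _ h)))
      · exact hsupp _ fun c h => hmap 2 _ (hmap 1 _ (hmap 0 _ h))
    · intro c y hy
      refine (σ.part g 2).add_of_notMem c fun h => ?_
      obtain ⟨z, -, rfl⟩ := Finset.mem_image.1 h
      exact (hg _ hy).not_ge (σ.bound_le_copy z)
    -- The value added to a copy is that of a register which `g` does not modify, so it is the same
    -- before and after `g`.
    · intro c c' h y hy
      change (σ.part g 2).add c' y = (σ.part g 2).add c y
      have hmod : y ∉ g.op.targets → ¬ g.Modifies y := fun h h' => h h'.1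
      by_cases hyc : y ∈ (σ.part g 2).dom.image (σ.part g 2).copy
      · rw [add, add, if_pos hyc, if_pos hyc, h y (hmod hy)]
        congr 1
        apply Fin.ext
        have hd := (σ.part g 2).ren_mem_dom hyc
        rw [Ren.act_val, Ren.act_val, h _ (σ.mem_restrict.1 hd).2.2]
      · rw [add_of_notMem _ _ hyc, add_of_notMem _ _ hyc, h y (hmod hy)]
  -- When the common guard fails, the moves, `g` and the renamed `g` are all off; the renaming fixes
  -- the controls in `G`.
  · have hK : ∀ k (s : State), (∀ c' ∈ s.support, c' = c) → K k s = s := by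
      intro k s hs
      have := (Gate.guarded G (σ.forward g k)).kraus_of_not_active 0 (s := s)
        fun c' hc' h => hA ((hact k c).1 (hs c' hc' ▸ h))
      rwa [if_pos rfl] at this
    have h1 : ∀ c' ∈ (Finsupp.single c (1 : ℂ)).support, c' = c := fun c' hc' =>
      Finset.mem_singleton.1 (Finsupp.support_single_subset hc')
    rw [hK 0 _ h1, hK 1 _ h1, hK 2 _ h1, Gate.kraus_of_not_active (g.rename σ.ren) x,
      Gate.kraus_of_not_active g x]
    · have h2 : ∀ c' ∈ (if x = 0 then Finsupp.single c (1 : ℂ) else 0).support, c' = c := by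
        intro c' hc'
        split_ifs at hc'
        · exact h1 c' hc'
        · simp at hc'
      rw [hK 3 _ h2, hK 4 _ h2, hK 5 _ h2]
    · intro c' hc' h
      rw [h1 c' hc'] at h
      exact hA fun p hp => h p (hG hp)
    · intro c' hc' h
      rw [h1 c' hc'] at h
      refine hA fun p hp => ?_
      have := h _ (g.mem_guard_rename σ.ren (y := p.1) (b := p.2) (hG hp))
      rwa [c.val_congr (σ.ren_of_notMem fun h => hGσ p hp (σ.mem_dom_of_mem_supp h (hsmall p hp)))]
        at this

/-- The exchange of the quantum (`b = true`) or classical registers of a slot with their copies. -/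
noncomputable def exchangeGate (σ : Slot) (b : Bool) : Gate :=
  Gate.guarded ∅ ((σ.restrict fun y => y.quantum = b).exchange.op b (σ.quantum_restrict fun _ h => h))

theorem targets_exchangeGate (b : Bool) :
    (σ.exchangeGate b).op.targets = (σ.restrict fun y => y.quantum = b).supp :=
  LocalPerm.targets_op _ _ _

theorem regs_exchangeGate {b : Bool} {y : Reg} (h : y ∈ (σ.exchangeGate b).regs) : y ∈ σ.supp := by
  obtain ⟨_, h⟩ | h := (Gate.mem_regs _).1 h
  · have : (σ.exchangeGate b).guard = ∅ := Gate.guard_guarded (by simp)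
    rw [this] at h
    simp at h
  · rw [targets_exchangeGate] at h
    exact σ.supp_restrict_subset _ h

theorem numOut_exchangeGate (b : Bool) : (σ.exchangeGate b).op.numOut = 1 :=
  LocalPerm.numOut_op _ _ _

theorem kraus_exchangeGate (b : Bool) (s : State) : (σ.exchangeGate b).kraus 0 s =
    s.mapDomain (σ.restrict fun y => y.quantum = b).ren.act := by
  refine Gate.kraus_of_active _ (fun c => LocalPerm.branch_op _ _ _ _ _) fun c _ p hp => ?_
  have : (σ.exchangeGate b).guard = ∅ := Gate.guard_guarded (by simp)
  rw [this] at hp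
  simp at hp

/-- A gate between exchanges acts as the renamed gate. -/
theorem kraus_exchange (s : State) (x : ℕ) :
    (σ.exchangeGate true).kraus 0 ((σ.exchangeGate false).kraus 0 (g.kraus x
      ((σ.exchangeGate false).kraus 0 ((σ.exchangeGate true).kraus 0 s)))) =
      (g.rename σ.ren).kraus x s := by
  simp only [kraus_exchangeGate, Gate.kraus_rename, ← Finsupp.mapDomain_comp]
  have h1 := σ.act_restrict_act_restrict (p := fun y => y.quantum = true)
    (q := fun y => y.quantum = false) (by simp)
  have h2 := σ.act_restrict_act_restrict (p := fun y => y.quantum = false)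
    (q := fun y => y.quantum = true) (by simp)
  have h1' := funext h1
  have h2' := funext h2
  simp only [Function.comp_def, h1', h2']

end Slot

/-! ### Orders and executions -/

/-- A list of all elements, each one once, in an order that is compatible with `r`. -/
structure IsListing {ι : Type} (r : ι → ι → Prop) (l : List ι) : Prop where
  nodup : l.Nodup
  all : ∀ i, i ∈ l
  compatible : l.Pairwise fun i j => ¬ r j i

theorem Circuit.isExecution_iff {C : Circuit} {v : Config} {l : List C.Idx} :
    C.IsExecution v l ↔ IsListing (C.lt v) l :=
  ⟨fun h => ⟨h.1, h.2, h.3⟩, fun h => ⟨h.1, h.2, h.3⟩⟩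

/-- The number of predecessors is strictly monotone along `r`, so sorting by it gives a compatible
order. -/
theorem StrictOrder.exists_isListing {ι : Type} [Fintype ι] {r : ι → ι → Prop}
    (h : StrictOrder r) : ∃ l, IsListing r l := by
  classical
  let rank : ι → ℕ := fun i => (Finset.univ.filter fun j => r j i).card
  have hrank : ∀ i j, r i j → rank i < rank j := fun i j hij => by
    refine Finset.card_lt_card ⟨fun k hk => ?_, fun hs => ?_⟩
    · simp only [Finset.mem_filter, Finset.mem_univ, true_and] at hk ⊢
      exact h.2 _ _ _ hk hij
    · have := hs (Finset.mem_filter.2 ⟨Finset.mem_univ i, hij⟩)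
      exact h.1 i (Finset.mem_filter.1 this).2
  let l := Finset.univ.toList.mergeSort fun i j => decide (rank i ≤ rank j)
  have hperm : l.Perm (Finset.univ : Finset ι).toList := List.mergeSort_perm _ _
  refine ⟨l, hperm.nodup_iff.2 (Finset.nodup_toList _), fun i => hperm.mem_iff.2 (by simp), ?_⟩
  refine (List.pairwise_mergeSort ?_ ?_ _).imp fun {i j} hij hr => ?_
  · intro i j k
    simpa using le_trans
  · intro i j
    simpa using le_total _ _
  · exact (hrank _ _ hr).not_ge (by simpa using hij)

/-- The order in which the elements of a listing appear. -/
theorem IsListing.strictOrder_idxOf {ι : Type} [DecidableEq ι] (l : List ι) :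
    StrictOrder fun i j => l.idxOf i < l.idxOf j :=
  ⟨fun _ => lt_irrefl _, fun _ _ _ => lt_trans⟩

namespace IsListing

variable {ι : Type} [DecidableEq ι] {r : ι → ι → Prop} {l : List ι}

theorem idxOf_total (h : IsListing r l) {i j : ι} (hij : i ≠ j) :
    l.idxOf i < l.idxOf j ∨ l.idxOf j < l.idxOf i :=
  lt_or_gt_of_ne fun e => hij ((List.idxOf_inj (h.all i)).1 e)

theorem idxOf_lt (h : IsListing r l) (hr : StrictOrder r) {i j : ι} (hij : r i j) :
    l.idxOf i < l.idxOf j := by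
  have hne : i ≠ j := fun e => hr.1 i (by rw [← e] at hij; exact hij)
  refine (h.idxOf_total hne).resolve_right fun hlt => ?_
  have hi := List.idxOf_lt_length_of_mem (h.all i)
  have hj := List.idxOf_lt_length_of_mem (h.all j)
  have := List.pairwise_iff_getElem.1 h.compatible _ _ hj hi hlt
  rw [List.getElem_idxOf, List.getElem_idxOf] at this
  exact this hij

theorem of_idxOf (h : IsListing r l) : IsListing (fun i j => l.idxOf i < l.idxOf j) l := by
  refine ⟨h.nodup, h.all, List.pairwise_iff_getElem.2 fun m n hm hn hmn => ?_⟩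
  rw [h.nodup.idxOf_getElem, h.nodup.idxOf_getElem]
  exact hmn.not_gt

end IsListing

/-- Two listings are permutations of each other, and totality makes "not later" antisymmetric, so a
sorted arrangement is unique. -/
theorem IsListing.eq_of_total {ι : Type} {r : ι → ι → Prop} (hr : ∀ i j, i ≠ j → r i j ∨ r j i)
    {l m : List ι} (hl : IsListing r l) (hm : IsListing r m) : l = m := by
  refine List.Perm.eq_of_pairwise (le := fun i j => ¬ r j i) ?_ hl.compatible hm.compatible
    ((List.perm_ext_iff_of_nodup hl.nodup hm.nodup).2 fun i => by simp [hl.all, hm.all])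
  intro i j _ _ h1 h2
  by_contra hne
  exact (hr i j hne).elim h2 h1

/-! ### Refinements of orders -/

/-- The order on `κ` by blocks, which are ordered by `r`, and by position in the block. -/
def Lex {ι κ : Type} (π : κ → ι) (pos : κ → ℕ) (r : ι → ι → Prop) (i j : κ) : Prop :=
  r (π i) (π j) ∨ π i = π j ∧ pos i < pos j

theorem StrictOrder.lex {ι κ : Type} {π : κ → ι} {pos : κ → ℕ} {r : ι → ι → Prop}
    (h : StrictOrder r) : StrictOrder (Lex π pos r) := by
  refine ⟨fun i hi => ?_, fun i j k hij hjk => ?_⟩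
  · exact hi.elim (h.1 _) fun h' => lt_irrefl _ h'.2
  · obtain h1 | ⟨h1, h1'⟩ := hij <;> obtain h2 | ⟨h2, h2'⟩ := hjk
    · exact .inl (h.2 _ _ _ h1 h2)
    · exact .inl (h2 ▸ h1)
    · exact .inl (h1 ▸ h2)
    · exact .inr ⟨h1.trans h2, h1'.trans h2'⟩

/-- `block i` lists the elements above `i` in the order of their positions. -/
structure IsBlocks {ι κ : Type} (π : κ → ι) (pos : κ → ℕ) (block : ι → List κ) : Prop where
  mem : ∀ i k, k ∈ block i ↔ π k = i
  sorted : ∀ i, (block i).Pairwise fun k m => pos k < pos m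

namespace IsBlocks

variable {ι κ : Type} {π : κ → ι} {pos : κ → ℕ} {block : ι → List κ} {r : ι → ι → Prop}

/-- Executions are refined by replacing every gate with its block, whose gates then run without
interruption. This carries executions to the reduction and to the simulator. -/
theorem isListing_flatMap (h : IsBlocks π pos block) (hr : ∀ i, ¬ r i i) {l : List ι}
    (hl : IsListing r l) : IsListing (Lex π pos r) (l.flatMap block) where
  nodup := by
    refine List.nodup_flatMap.2 ⟨fun i _ => (h.sorted i).imp fun hlt e => hlt.ne (by rw [e]), ?_⟩
    refine hl.nodup.imp fun {i j} hij k hi hj => hij ?_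
    rw [← (h.mem i k).1 hi, (h.mem j k).1 hj]
  all k := List.mem_flatMap.2 ⟨π k, hl.all _, (h.mem _ k).2 rfl⟩
  compatible := by
    refine List.pairwise_flatMap.2 ⟨fun i _ => ?_, ?_⟩
    · refine (h.sorted i).imp_of_mem fun {k m} hk hm hlt => ?_
      rw [h.mem] at hk hm
      rintro (h' | ⟨-, h'⟩)
      · rw [hk, hm] at h'
        exact hr i h'
      · exact h'.not_gt hlt
    · refine (hl.compatible.and hl.nodup).imp fun {i j} hij k hk m hm => ?_
      rw [h.mem] at hk hm
      rintro (h' | ⟨h', -⟩)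
      · rw [hk, hm] at h'
        exact hij.1 h'
      · rw [hk, hm] at h'
        exact hij.2 h'.symm

theorem pos_injective (h : IsBlocks π pos block) {k m : κ} (h1 : π k = π m) (h2 : pos k = pos m) :
    k = m := by
  by_contra hne
  have hk := (h.mem (π m) k).2 h1
  have hm := (h.mem (π m) m).2 rfl
  have hp : (block (π m)).Pairwise fun k m => pos k ≠ pos m := (h.sorted _).imp fun h => h.ne
  have : Std.Symm fun k m : κ => pos k ≠ pos m := ⟨fun _ _ h => h.symm⟩
  exact hp.forall hk hm hne h2

theorem lex_total (h : IsBlocks π pos block) (hr : ∀ i j, i ≠ j → r i j ∨ r j i) (k m : κ)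
    (hkm : k ≠ m) : Lex π pos r k m ∨ Lex π pos r m k := by
  by_cases hπ : π k = π m
  · rcases lt_trichotomy (pos k) (pos m) with hlt | heq | hlt
    · exact .inl (.inr ⟨hπ, hlt⟩)
    · exact absurd (h.pos_injective hπ heq) hkm
    · exact .inr (.inr ⟨hπ.symm, hlt⟩)
  · exact (hr _ _ hπ).imp .inl .inl

end IsBlocks

/-! ### Simulators as parts of ideal adversaries -/

variable {P : Protocol} {I : IdealProtocol P} {E : Env P}

/-- What an adversary gate does is allowed to an ideal adversary. -/
theorem Env.Valid.idealAccess (hE : E.Valid I) (a : E.Adv) :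
    IdealAccess I (E.gate (.inr a)) := by
  obtain ⟨h1, h2⟩ := hE.adv a
  refine ⟨fun y hy hc => (h2 y ((Gate.mem_regs _).2 (.inr hy))).2.2.2 hc hy,
    .inr ⟨E.role a, h1, fun y hy => ⟨fun hio => (h2 y hy).2.2.1 (.inr hio), fun hI => ?_⟩⟩⟩
  exact absurd hI (hE.ideal_fresh _ y hy)

namespace Simulator

variable (S : Simulator I E)

/-- The adversary together with the simulator. -/
def toIdealAdv : IdealAdv I E where
  Idx := E.Adv ⊕ S.Idx
  fin := inferInstance
  gate := Sum.elim (fun a => E.gate (.inr a)) S.gate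
  ord v i j := S.ord v (Sum.map (Equiv.sumAssoc _ _ _).symm id i)
    (Sum.map (Equiv.sumAssoc _ _ _).symm id j)

/-- The gates of both ideal sides are the same. -/
def idealEquiv : S.toIdealAdv.ideal.Idx ≃ S.ideal.Idx :=
  (Equiv.sumAssoc E.App E.Adv S.Idx).symm.sumCongr (Equiv.refl I.body.Idx)

theorem gate_idealEquiv (i : S.toIdealAdv.ideal.Idx) :
    S.ideal.gate (S.idealEquiv i) = S.toIdealAdv.ideal.gate i := by
  rcases i with (i | i | i) | i <;> rfl

theorem lt_idealEquiv (v : Config) (i j : S.toIdealAdv.ideal.Idx) :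
    S.ideal.lt v (S.idealEquiv i) (S.idealEquiv j) ↔ S.toIdealAdv.ideal.lt v i j :=
  Iff.rfl

theorem size_toIdealAdv : S.toIdealAdv.size ≤ E.size + S.size := by
  have h1 : S.toIdealAdv.size = Fintype.card E.Adv + S.size := Fintype.card_sum
  have h2 : E.size = Fintype.card E.App + Fintype.card E.Adv := Fintype.card_sum
  omega

variable {S}

/-- The circuit conditions transfer along the reassociation `idealEquiv`. What remains is access:
adversary gates respect it by `Env.Valid.idealAccess`, and a simulator avoids all registers of the
environment, in particular the application's own ones. -/
theorem Valid.toIdealAdv (hE : E.Valid I) (hS : S.Valid) : S.toIdealAdv.Valid where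
  isCircuit :=
    { order := fun v => ⟨fun i => (hS.isCircuit.order v).1 _,
        fun i j k => (hS.isCircuit.order v).2 _ _ _⟩
      comparable := fun v i j hij h => by
        rw [← lt_idealEquiv, ← lt_idealEquiv]
        refine hS.isCircuit.comparable v _ _ (S.idealEquiv.injective.ne hij) ?_
        rwa [gate_idealEquiv, gate_idealEquiv] }
  ord_app v a b h := hS.ord_env v _ _ h
  ord_protocol v p q h := hS.ord_protocol v p q h
  activated v p a hp j hj hm := by
    refine hS.activated v p a hp (S.idealEquiv j) (fun e => hj ?_) ?_
    · exact S.idealEquiv.injective e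
    · rwa [gate_idealEquiv]
  access i := by
    rcases i with a | s
    · exact hE.idealAccess a
    · exact hS.access s
  own_fresh i y hy ho := by
    rcases i with a | s
    · exact ((hE.adv a).2 y hy).1 ho
    · exact hS.env_fresh s y hy ⟨.inl ho, (hE.own_fresh y ho).1⟩

/-- Executions correspond along `idealEquiv`, with the same list of gates. -/
theorem close_toIdealAdv {C : Circuit} {Z : Reg} {v : Config} {ε : ℝ}
    (h : Close C S.ideal Z v ε) : Close C S.toIdealAdv.ideal Z v ε := by
  intro l m hl hm
  have hm' : S.ideal.IsExecution v (m.map S.idealEquiv) :=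
    { nodup := hm.nodup.map S.idealEquiv.injective
      all := fun i => List.mem_map.2 ⟨S.idealEquiv.symm i, hm.all _, by simp⟩
      compatible := List.pairwise_map.2 (hm.compatible.imp fun h => h) }
  have hg : S.ideal.prob Z v (m.map S.idealEquiv) = S.toIdealAdv.ideal.prob Z v m := by
    rw [Circuit.prob, Circuit.prob, List.map_map]
    congr 1
    exact List.map_congr_left fun i _ => S.gate_idealEquiv i
  rw [← hg]
  exact h l _ hl hm'

end Simulator

/-! ### The reduction to a dummy adversary -/

theorem Protocol.finite_internal (P : Protocol) : P.internal.Finite := by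
  have : Finite P.Role := @Finite.of_fintype _ P.roleFin
  have h : P.internal = (⋃ r, (P.priv r : Set Reg)) ∪ P.chan := by
    ext y
    simp [Protocol.internal]
  rw [h]
  exact (Set.finite_iUnion fun r => (P.priv r).finite_toSet).union P.chan.finite_toSet

theorem Protocol.finite_corr (P : Protocol) : P.corr.Finite := by
  have : Finite P.Role := @Finite.of_fintype _ P.roleFin
  -- Roles without a corruption bit get a dummy register; a finite set containing `P.corr` is
  -- enough.
  refine (Set.finite_range fun r : P.Role => match P.status r with
    | .corruptible y => y
    | _ => ⟨0, false, 0⟩).subset ?_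
  rintro y ⟨r, hr⟩
  exact ⟨r, by simp [hr]⟩

theorem Protocol.finite_regs (P : Protocol) : P.regs.Finite :=
  P.finite_internal.union (P.io.finite_toSet.union P.finite_corr)

theorem Protocol.WellFormed.body_regs {P : Protocol} (h : P.WellFormed) (i : P.body.Idx) :
    ∀ y ∈ (P.body.gate i).regs, y ∈ P.regs := by
  intro y hy
  obtain h | ⟨h | h, -⟩ | ⟨h, -⟩ := h.access i y hy
  · exact .inl (.inl ⟨_, h⟩)
  · exact .inl (.inr h)
  · exact .inr (.inl h)
  · exact .inr (.inr ⟨_, h⟩)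

theorem Protocol.WellFormed.internal_io {P : Protocol} (h : P.WellFormed) {y : Reg}
    (hy : y ∈ P.internal) : y ∉ P.io := by
  obtain ⟨r, hr⟩ | hc := hy
  · exact Finset.disjoint_left.1 (h.priv_io r) hr
  · exact Finset.disjoint_left.1 h.chan_io hc

theorem Status.advGuard_subset {s : Status} {g : Gate} (h : s.AdvGate g) : s.advGuard ⊆ g.guard := by
  cases s with
  | honest => exact h.elim
  | corruptible C => exact Finset.singleton_subset_iff.2 h
  | corrupted => exact Finset.empty_subset _

theorem Status.advGate_of_guard {s : Status} {g g' : Gate} (h : s.AdvGate g)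
    (hg : s.advGuard ⊆ g'.guard) : s.AdvGate g' := by
  cases s with
  | honest => exact h.elim
  | corruptible C => exact Finset.singleton_subset_iff.1 hg
  | corrupted => trivial

theorem Protocol.mem_corr_of_mem_advGuard {P : Protocol} {r : P.Role} {p : Reg × ℕ}
    (hp : p ∈ (P.status r).advGuard) : p.1 ∈ P.corr := by
  cases hs : P.status r with
  | corruptible C =>
    rw [hs] at hp
    obtain rfl := Finset.mem_singleton.1 hp
    exact ⟨r, hs⟩
  | _ =>
    rw [hs] at hp
    exact absurd hp (Finset.notMem_empty _)

/-! ### Construction of the reduced environment -/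

namespace Env

variable {P : Protocol} (I : IdealProtocol P) (E : Env P)

/-- The names of all registers in use are bounded. -/
theorem exists_bound : ∃ N, ∀ y : Reg,
    y ∈ E.own ∨ (∃ e, y ∈ (E.gate e).regs) ∨ y ∈ P.regs ∨ y ∈ I.internal → y.name < N := by
  have hfin : {y : Reg | y ∈ E.own ∨ (∃ e, y ∈ (E.gate e).regs) ∨ y ∈ P.regs ∨ y ∈ I.internal}.Finite := by
    have h : (⋃ e, ((E.gate e).regs : Set Reg)).Finite :=
      Set.finite_iUnion fun e => (E.gate e).regs.finite_toSet
    refine (E.own.finite_toSet.union (h.union (P.finite_regs.union I.finite_internal))).subset ?_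
    rintro y (h | ⟨e, h⟩ | h | h)
    · exact .inl h
    · exact .inr (.inl (Set.mem_iUnion.2 ⟨e, h⟩))
    · exact .inr (.inr (.inl h))
    · exact .inr (.inr (.inr h))
  obtain ⟨N, hN⟩ := (hfin.image Reg.name).bddAbove
  exact ⟨N + 1, fun y hy => Nat.lt_succ_of_le (hN ⟨y, hy, rfl⟩)⟩

noncomputable def bound : ℕ := (E.exists_bound I).choose

variable {I E} in
theorem lt_bound {y : Reg}
    (h : y ∈ E.own ∨ (∃ e, y ∈ (E.gate e).regs) ∨ y ∈ P.regs ∨ y ∈ I.internal) :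
    y.name < E.bound I :=
  (E.exists_bound I).choose_spec y h

open Classical in
/-- The circuit in whose name the dummy adversary forwards for a gate of the environment: that of the
adversary gate, and for an application gate one that is corrupted all the time, if there is any. -/
noncomputable def mover : E.App ⊕ E.Adv → Option P.Role
  | .inl _ => if h : P.HasEve then some h.choose else none
  | .inr a => some (E.role a)

open Classical in
/-- The registers of the protocol that are forwarded for a gate of the environment. -/
noncomputable def slot (e : E.App ⊕ E.Adv) : Slot where
  bound := E.bound I
  key := Fintype.equivFin (E.App ⊕ E.Adv) e
  dom := (E.gate e).regs.filter fun y => y ∈ P.internal ∧ E.mover e ≠ none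
  small _ hy := lt_bound (.inr (.inl ⟨e, (Finset.mem_filter.1 hy).1⟩))

variable {I E}

theorem mem_slot {e : E.App ⊕ E.Adv} {y : Reg} :
    y ∈ (E.slot I e).dom ↔ y ∈ (E.gate e).regs ∧ y ∈ P.internal ∧ E.mover e ≠ none := by
  simp [slot]

theorem slot_subset {e : E.App ⊕ E.Adv} : ∀ y ∈ (E.slot I e).dom, y ∈ (E.gate e).regs :=
  fun _ hy => (mem_slot.1 hy).1

theorem slot_internal {e : E.App ⊕ E.Adv} : ∀ y ∈ (E.slot I e).dom, y ∈ P.internal :=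
  fun _ hy => (mem_slot.1 hy).2.1

theorem slot_regs {e : E.App ⊕ E.Adv} : ∀ y ∈ (E.slot I e).dom, y ∈ P.regs :=
  fun y hy => .inl (slot_internal y hy)

theorem internal_of_mem_part {e : E.App ⊕ E.Adv} {k : Fin 6} {y : Reg}
    (h : y ∈ ((E.slot I e).part (E.gate e) k).supp) (hy : y.name < E.bound I) : y ∈ P.internal :=
  slot_internal y ((E.slot I e).part_dom_subset (E.gate e) k
    (((E.slot I e).part (E.gate e) k).mem_dom_of_mem_supp h (by rwa [Slot.part_bound])))

/-- The number of the environment gate is encoded in the name of the copy by `Nat.pair`. Hence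
copies never create a conflict between different blocks. -/
theorem slot_copy_inj {e f : E.App ⊕ E.Adv} {y z : Reg}
    (h : (E.slot I e).copy y = (E.slot I f).copy z) : e = f := by
  have h1 := congrArg Reg.name h
  simp only [Slot.copy, slot, Nat.add_left_cancel_iff, Nat.pair_eq_pair] at h1
  exact (Fintype.equivFin _).injective (Fin.ext h1.1)

theorem copy_fresh {e : E.App ⊕ E.Adv} {y z : Reg}
    (h : z ∈ E.own ∨ (∃ e, z ∈ (E.gate e).regs) ∨ z ∈ P.regs ∨ z ∈ I.internal) :
    (E.slot I e).copy y ≠ z := by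
  rintro rfl
  exact (lt_bound h).not_ge ((E.slot I e).bound_le_copy y)

theorem copy_notMem_regs {e : E.App ⊕ E.Adv} (y : Reg) : (E.slot I e).copy y ∉ P.regs :=
  fun h => copy_fresh (E := E) (.inr (.inr (.inl h))) rfl

variable (I E)

/-- The environment gate a gate of the reduced environment belongs to. -/
def redProj : (E.App ⊕ E.Adv) ⊕ ({e // (E.mover e).isSome} × Fin 6) → E.App ⊕ E.Adv
  | .inl e => e
  | .inr a => a.1.1

/-- The position of a gate of the reduced environment between the forwarding steps. -/
def redPos : (E.App ⊕ E.Adv) ⊕ ({e // (E.mover e).isSome} × Fin 6) → ℕ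
  | .inl _ => 3
  -- The shift by one leaves position 3 to the gate that is surrounded.
  | .inr a => if (a.2 : ℕ) < 3 then a.2 else a.2 + 1

noncomputable def moverRole (e : {e // (E.mover e).isSome}) : P.Role := (E.mover e.1).get e.2

/-- The renamed gate retains all its controls, on copies where these are forwarded, while the moves
carry only the corruption control that a dummy adversary is allowed. -/
noncomputable def redGate : (E.App ⊕ E.Adv) ⊕ ({e // (E.mover e).isSome} × Fin 6) → Gate
  | .inl e => (E.gate e).rename (E.slot I e).ren
  | .inr a => Gate.guarded (P.status (E.moverRole a.1)).advGuard
      ((E.slot I a.1.1).forward (E.gate a.1.1) a.2)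

open Classical in
/-- The environment in which the adversary only forwards registers of the protocol to fresh ones, on
which the application executes the gates of the adversary of `E`. If there is a circuit that is
corrupted all the time, then the internal channels are forwarded to the application, too. -/
noncomputable def red : Env P where
  App := E.App ⊕ E.Adv
  Adv := {e // (E.mover e).isSome} × Fin 6
  appFin := inferInstance
  advFin := inferInstance
  gate := E.redGate I
  lt v := Lex E.redProj E.redPos (E.lt v)
  role a := E.moverRole a.1
  ord v := Lex (Sum.map E.redProj id) (Sum.elim E.redPos fun _ => 0) (E.ord v)
  -- All registers of `E` outside `P` become the application's own, also those used by the former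
  -- adversary, so an ideal adversary cannot touch them. The copies stay outside, because the dummy
  -- adversary has to reach them.
  own := (E.own ∪ Finset.univ.biUnion fun e => (E.gate e).regs).filter fun y => y ∉ P.regs
  Z := E.Z

variable {I E}

theorem mem_red_own {y : Reg} :
    y ∈ (E.red I).own ↔ (y ∈ E.own ∨ ∃ e, y ∈ (E.gate e).regs) ∧ y ∉ P.regs := by
  simp [red]

theorem red_pos_injective {i j : (E.App ⊕ E.Adv) ⊕ ({e // (E.mover e).isSome} × Fin 6)}
    (h1 : E.redProj i = E.redProj j) (h2 : E.redPos i = E.redPos j) : i = j := by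
  rcases i with e | ⟨e, k⟩ <;> rcases j with f | ⟨f, m⟩ <;>
    simp only [redProj, redPos] at h1 h2
  · rw [h1]
  · split_ifs at h2 <;> omega
  · split_ifs at h2 <;> omega
  · have : k = m := by
      apply Fin.ext
      split_ifs at h2 <;> omega
    rw [this, Subtype.ext h1]

theorem moverRole_spec (e : {e // (E.mover e).isSome}) : E.mover e.1 = some (E.moverRole e) :=
  (Option.some_get e.2).symm

/-- This puts the guard of the moves among the controls of the gate they serve, so that moves that
are off imply a gate that is off. For application gates the mover is always corrupted and the guard
is empty. -/
theorem mover_advGate (hE : E.Valid I) {e : E.App ⊕ E.Adv} {r : P.Role} (h : E.mover e = some r) :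
    (P.status r).AdvGate (E.gate e) := by
  rcases e with a | a
  · by_cases hP : P.HasEve
    · rw [mover, dif_pos hP, Option.some.injEq] at h
      rw [← h, hP.choose_spec]
      trivial
    · rw [mover, dif_neg hP] at h
      simp at h
  · rw [mover, Option.some.injEq] at h
    rw [← h]
    exact (hE.adv a).1

/-- The filter in `Gate.guarded` removes nothing: corruption bits are classical, and they are
neither internal registers of `P` nor copies. -/
theorem guard_redGate (hP : P.WellFormed)
    (a : {e // (E.mover e).isSome} × Fin 6) :
    (E.redGate I (.inr a)).guard = (P.status (E.moverRole a.1)).advGuard := by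
  refine Gate.guard_guarded fun p hp => ?_
  have hc := Protocol.mem_corr_of_mem_advGuard hp
  refine ⟨(hP.corr_bit _ hc).1, fun ht => (hP.corr_fresh _ hc).1 ?_⟩
  rw [Slot.targets_forward] at ht
  exact internal_of_mem_part ht (lt_bound (.inr (.inr (.inl (.inr (.inr hc))))))

/-- The registers of the reduced environment are the old ones and copies. -/
theorem regs_redGate (hP : P.WellFormed) (hE : E.Valid I)
    {i : (E.App ⊕ E.Adv) ⊕ ({e // (E.mover e).isSome} × Fin 6)} {y : Reg}
    (h : y ∈ (E.redGate I i).regs) :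
    y ∈ (E.gate (E.redProj i)).regs ∨ ∃ z ∈ (E.slot I (E.redProj i)).dom,
      (E.slot I (E.redProj i)).copy z = y := by
  rcases i with e | ⟨e, k⟩
  · have h : (E.slot I e).ren y ∈ (E.gate e).regs := (Gate.mem_regs_rename _ _).1 h
    by_cases hs : y ∈ (E.slot I e).supp
    · exact ((Slot.mem_supp _).1 hs).imp_left (slot_subset y)
    · rw [Slot.ren_of_notMem _ hs] at h
      exact .inl h
  · obtain ⟨b, hb⟩ | ht := (Gate.mem_regs _).1 h
    · rw [guard_redGate hP] at hb
      exact .inl ((Gate.mem_regs _).2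
        (.inl ⟨b, Status.advGuard_subset (mover_advGate hE (moverRole_spec e)) hb⟩))
    · change y ∈ ((E.slot I e.1).forward (E.gate e.1) k).targets at ht
      rw [Slot.targets_forward, Slot.mem_supp, Slot.part_copy] at ht
      refine ht.imp (fun h => slot_subset y (Slot.part_dom_subset _ _ _ h)) ?_
      exact fun ⟨z, hz, e⟩ => ⟨z, Slot.part_dom_subset _ _ _ hz, e⟩

theorem regs_redGate_of_lt (hP : P.WellFormed) (hE : E.Valid I)
    {i : (E.App ⊕ E.Adv) ⊕ ({e // (E.mover e).isSome} × Fin 6)} {y : Reg}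
    (h : y ∈ (E.redGate I i).regs) (hy : y.name < E.bound I) :
    y ∈ (E.gate (E.redProj i)).regs := by
  refine (regs_redGate hP hE h).resolve_right ?_
  rintro ⟨z, -, rfl⟩
  exact hy.not_ge ((E.slot I _).bound_le_copy z)

/-- On old registers the gates of a block do no more than the gate they replace: the renamed gate
has given up the forwarded registers, and the moves alter only those that the original modifies.
Channel-types and the activation rule are inherited through this. -/
theorem modifies_redGate
    {i : (E.App ⊕ E.Adv) ⊕ ({e // (E.mover e).isSome} × Fin 6)} {y : Reg}
    (hy : y.name < E.bound I) (h : (E.redGate I i).Modifies y) :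
    (E.gate (E.redProj i)).Modifies y := by
  rcases i with e | ⟨e, k⟩
  · have h : (E.gate e).Modifies ((E.slot I e).ren y) := Gate.Modifies.of_rename h
    by_cases hs : y ∈ (E.slot I e).supp
    · rw [Slot.ren_of_mem _ (Slot.mem_dom_of_mem_supp _ hs hy)] at h
      exact absurd rfl (copy_fresh (I := I) (.inr (.inl ⟨e, h.mem_regs⟩)))
    · rw [Slot.ren_of_notMem _ hs] at h
      exact h
  · exact Slot.modifies_of_forward _ slot_subset hy h

theorem permits_redGate (hP : P.WellFormed) (hE : E.Valid I)
    {i : (E.App ⊕ E.Adv) ⊕ ({e // (E.mover e).isSome} × Fin 6)} {y : Reg}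
    (hy : y.name < E.bound I) (h : y ∈ (E.redGate I i).regs) {a : Access}
    (ha : a.Permits (E.gate (E.redProj i)) y) : a.Permits (E.redGate I i) y := by
  cases a with
  | no => exact absurd (regs_redGate_of_lt hP hE h hy) ha
  | read => exact ⟨fun hm => ha.1 (modifies_redGate hy hm), ha.2⟩
  | full => trivial

/-- The application of the reduced environment does not access forwarded registers. -/
theorem internal_redGate (hP : P.WellFormed) (hE : E.Valid I) {e : E.App ⊕ E.Adv}
    (he : E.mover e ≠ none) {y : Reg} (h : y ∈ (E.redGate I (.inl e)).regs) : y ∉ P.internal := by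
  intro hi
  have hy : y.name < E.bound I := lt_bound (.inr (.inr (.inl (.inl hi))))
  have hd : y ∈ (E.slot I e).dom :=
    mem_slot.2 ⟨regs_redGate_of_lt (i := .inl e) hP hE h hy, hi, he⟩
  have h : (E.slot I e).ren y ∈ (E.gate e).regs := (Gate.mem_regs_rename _ _).1 h
  rw [Slot.ren_of_mem _ hd] at h
  exact copy_fresh (I := I) (.inr (.inl ⟨e, h⟩)) rfl

/-- A shared register with a name beyond the bound is a copy, and a copy determines its block. -/
theorem redProj_eq_of_copy (hP : P.WellFormed) (hE : E.Valid I)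
    {i j : (E.App ⊕ E.Adv) ⊕ ({e // (E.mover e).isSome} × Fin 6)} {y : Reg}
    (hi : y ∈ (E.redGate I i).regs) (hj : y ∈ (E.redGate I j).regs) (hy : ¬ y.name < E.bound I) :
    E.redProj i = E.redProj j := by
  obtain hi | ⟨z, -, hi⟩ := regs_redGate hP hE hi
  · exact absurd (lt_bound (.inr (.inl ⟨_, hi⟩))) hy
  obtain hj | ⟨w, -, hj⟩ := regs_redGate hP hE hj
  · exact absurd (lt_bound (.inr (.inl ⟨_, hj⟩))) hy
  exact slot_copy_inj (hi.trans hj.symm)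

theorem red_dummyAccess (hP : P.WellFormed) (a : {e // (E.mover e).isSome} × Fin 6)
    {y : Reg} (hy : y ∈ (E.redGate I (.inr a)).regs) :
    y ∈ P.corr ∨ y ∈ P.internal ∨ ¬ y.name < E.bound I := by
  obtain ⟨b, hb⟩ | ht := (Gate.mem_regs _).1 hy
  · rw [guard_redGate hP] at hb
    exact .inl (Protocol.mem_corr_of_mem_advGuard hb)
  · change y ∈ ((E.slot I a.1.1).forward (E.gate a.1.1) a.2).targets at ht
    rw [Slot.targets_forward] at ht
    exact .inr (or_iff_not_imp_right.2 fun hlt => internal_of_mem_part ht (not_not.1 hlt))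

/-! ### Validity, dummy form and size of the reduced environment -/

theorem red_appAccess (hP : P.WellFormed) (hE : E.Valid I) : (E.red I).AppAccess := by
  intro e y hy
  change y ∈ (E.redGate I (.inl e)).regs at hy
  by_cases he : E.mover e = none
  · obtain a | a := e
    · have key : y ∈ P.internal → y.name < E.bound I ∧ y ∈ (E.gate (.inl a)).regs := fun h =>
        have hlt := lt_bound (.inr (.inr (.inl (.inl h))))
        ⟨hlt, regs_redGate_of_lt (i := .inl (.inl a)) hP hE hy hlt⟩
      refine ⟨fun r hr => (hE.app a y (key (.inl ⟨r, hr⟩)).2).1 r hr, fun hc => ?_⟩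
      exact permits_redGate (i := .inl (.inl a)) hP hE (key (.inr hc)).1 hy
        ((hE.app a y (key (.inr hc)).2).2 hc)
    · simp [mover] at he
  · have := internal_redGate hP hE he hy
    exact ⟨fun r hr => absurd (.inl ⟨r, hr⟩) this, fun hc => absurd (.inr hc) this⟩

/-- The moves act in the name of the mover and need no more rights than the original gate had.
Input/output channels are never forwarded, since the application may use them itself. -/
theorem red_advAccess (hP : P.WellFormed) (hE : E.Valid I) : (E.red I).AdvAccess := by
  intro a
  refine ⟨?_, fun y hy => ?_⟩
  · exact Status.advGate_of_guard (mover_advGate hE (moverRole_spec a.1))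
      (guard_redGate (I := I) hP a).ge
  change y ∈ (E.redGate I (.inr a)).regs at hy
  have hacc := red_dummyAccess hP a hy
  have hlt : y ∈ P.regs → y.name < E.bound I := fun h => lt_bound (.inr (.inr (.inl h)))
  have hold : y ∈ P.regs → y ∈ (E.gate a.1.1).regs := fun h =>
    regs_redGate_of_lt (i := .inr a) hP hE hy (hlt h)
  refine ⟨fun ho => ?_, fun r hr => ?_, fun hc => ?_, fun hc ht => ?_⟩
  · obtain ⟨ho, hn⟩ := mem_red_own.1 ho
    obtain h | h | h := hacc
    · exact hn (.inr (.inr h))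
    · exact hn (.inl h)
    · exact h (lt_bound (ho.imp_right fun h => .inl h))
  · have hy' := hold (.inl (.inl ⟨r, hr⟩))
    obtain ⟨⟨b | b, hb⟩, k⟩ := a
    · exact absurd hr ((hE.app b y hy').1 r)
    · exact ((hE.adv b).2 y hy').2.1 r hr
  · have hreg : y ∈ P.regs := hc.elim (fun h => .inl (.inr h)) fun h => .inr (.inl h)
    have hy' := hold hreg
    have hperm : ∀ {b : Access}, b.Permits (E.gate a.1.1) y → b.Permits (E.redGate I (.inr a)) y :=
      fun hb => permits_redGate (i := .inr a) hP hE (hlt hreg) hy hb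
    obtain ⟨⟨b | b, hb⟩, k⟩ := a
    -- An application gate used the channel in nobody's name, and the always corrupted mover may do
    -- the same.
    · obtain hc | hio := hc
      · exact .inr (hperm ((hE.app b y hy').2 hc))
      · obtain h | h | h := hacc
        · exact absurd hio (hP.corr_fresh y h).2
        · exact absurd hio (hP.internal_io h)
        · exact absurd (hlt hreg) h
    · exact (((hE.adv b).2 y hy').2.2.1 hc).imp hperm hperm
  · change y ∈ ((E.slot I a.1.1).forward (E.gate a.1.1) a.2).targets at ht
    rw [Slot.targets_forward] at ht
    exact (hP.corr_fresh y hc).1 (internal_of_mem_part ht (hlt (.inr (.inr hc))))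

/-- Within a block the positions decide. Gates of different blocks can share only an old register,
which the original gates then share too, so these are already ordered. -/
theorem red_isCircuit (hP : P.WellFormed) (hE : E.Valid I) : (E.red I).circuit.IsCircuit where
  order v := (hE.isCircuit.order v).lex
  comparable v i j hij hd := by
    obtain ⟨y, hi, hj⟩ := Finset.not_disjoint_iff.1 hd
    by_cases hπ : E.redProj i = E.redProj j
    · rcases lt_trichotomy (E.redPos i) (E.redPos j) with h | h | h
      · exact .inl (.inr ⟨hπ, h⟩)
      · exact absurd (red_pos_injective hπ h) hij
      · exact .inr (.inr ⟨hπ.symm, h⟩)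
    · have hy : y.name < E.bound I := by
        by_contra hy
        exact hπ (redProj_eq_of_copy hP hE hi hj hy)
      exact (hE.isCircuit.comparable v _ _ hπ (Finset.not_disjoint_iff.2
        ⟨y, regs_redGate_of_lt hP hE hi hy, regs_redGate_of_lt hP hE hj hy⟩)).imp .inl .inl

theorem regs_real_red (hP : P.WellFormed) (hE : E.Valid I) {i : (E.red I).real.Idx} {y : Reg}
    (h : y ∈ ((E.red I).real.gate i).regs) (hy : y.name < E.bound I) :
    y ∈ (E.real.gate (Sum.map E.redProj id i)).regs := by
  rcases i with i | p
  · exact regs_redGate_of_lt hP hE h hy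
  · exact h

theorem red_isCircuit_real (hP : P.WellFormed) (hE : E.Valid I) :
    (E.red I).real.IsCircuit where
  order v := (hE.isCircuit_real.order v).lex
  comparable v i j hij hd := by
    obtain ⟨y, hi, hj⟩ := Finset.not_disjoint_iff.1 hd
    by_cases hπ : Sum.map E.redProj id i = Sum.map E.redProj id j
    · rcases i with i | p <;> rcases j with j | q
      · have hπ : E.redProj i = E.redProj j := Sum.inl_injective hπ
        rcases lt_trichotomy (E.redPos i) (E.redPos j) with h | h | h
        · exact .inl (.inr ⟨congrArg Sum.inl hπ, h⟩)
        · exact absurd (congrArg _ (red_pos_injective hπ h)) hij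
        · exact .inr (.inr ⟨congrArg Sum.inl hπ.symm, h⟩)
      · cases hπ
      · cases hπ
      · exact absurd (congrArg _ (Sum.inr_injective hπ)) hij
    · have hy : y.name < E.bound I := by
        rcases i with i | p
        · rcases j with j | q
          · by_contra hy
            exact hπ (congrArg Sum.inl (redProj_eq_of_copy hP hE hi hj hy))
          · exact lt_bound (.inr (.inr (.inl (hP.body_regs q y hj))))
        · exact lt_bound (.inr (.inr (.inl (hP.body_regs p y hi))))
      exact (hE.isCircuit_real.comparable v _ _ hπ (Finset.not_disjoint_iff.2
        ⟨y, regs_real_red hP hE hi hy, regs_real_red hP hE hj hy⟩)).imp .inl .inl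

theorem Valid.red (hP : P.WellFormed) (hE : E.Valid I) : (E.red I).Valid I where
  isCircuit := red_isCircuit hP hE
  isCircuit_real := red_isCircuit_real hP hE
  ord_env v i j h := h.imp (hE.ord_env v _ _) fun h => ⟨congrArg Sum.inl h.1, h.2⟩
  ord_protocol v p q h := .inl (hE.ord_protocol v p q h)
  activated v p a hp j hj hm := by
    refine .inl (hE.activated v p a hp _ ?_ ?_)
    · rcases j with j | q
      · exact Sum.inl_ne_inr
      · exact fun h => hj (congrArg Sum.inr (Sum.inr_injective h))
    · rcases j with j | q
      -- Activation registers are old registers, so whichever gate of a block sets one, the original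
      -- gate sets it and precedes the communication gate.
      · refine modifies_redGate (lt_bound (.inr (.inr (.inl ?_)))) hm
        exact (hP.act_guard p a hp).2.elim (fun h => .inl (.inr h)) fun h => .inr (.inl h)
      · exact hm
  app := red_appAccess hP hE
  adv := red_advAccess hP hE
  own_fresh y hy := by
    obtain ⟨h1, h2⟩ := mem_red_own.1 hy
    refine ⟨h2, ?_⟩
    obtain h | ⟨e, h⟩ := h1
    · exact (hE.own_fresh y h).2
    · exact hE.ideal_fresh e y h
  ideal_fresh i y hy hI :=
    hE.ideal_fresh _ y (regs_redGate_of_lt hP hE hy (lt_bound (.inr (.inr (.inr hI))))) hI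
  Z_own := mem_red_own.2 ⟨.inl hE.Z_own, (hE.own_fresh _ hE.Z_own).1⟩
  Z_bit := hE.Z_bit

theorem isDummy_red (hP : P.WellFormed) : (E.red I).IsDummy := fun a =>
  ⟨guard_redGate hP a, Slot.isForwarding_forward _ _ slot_regs copy_notMem_regs _⟩

theorem noDirectChannel_red (hP : P.WellFormed) (hE : E.Valid I) (h : P.HasEve) :
    (E.red I).NoDirectChannel := by
  intro e y hy hc
  refine internal_redGate hP hE ?_ hy (.inr hc)
  rcases e with a | a <;> simp [mover, h]

theorem size_red : (E.red I).size ≤ 7 * E.size := by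
  classical
  have h1 : (E.red I).size = E.size + Fintype.card {e // (E.mover e).isSome} * 6 := by
    change Fintype.card ((E.App ⊕ E.Adv) ⊕ ({e // (E.mover e).isSome} × Fin 6)) = _
    rw [Fintype.card_sum, Fintype.card_prod, Fintype.card_fin]
    rfl
  have h2 : Fintype.card {e // (E.mover e).isSome} ≤ E.size := Fintype.card_subtype_le _
  omega

/-- The reduction's application owns more registers, so it admits at least the initial values of
`E`. -/
theorem initial_red (hE : E.Valid I) {v : Config} (hv : E.Initial v) : (E.red I).Initial v :=
  fun y hy => hv y fun h => hy (mem_red_own.2 ⟨.inl h, (hE.own_fresh y h).1⟩)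

/-! ### The analysed side of the reduction -/

variable (E)

/-- The gates that replace a gate of the environment. -/
noncomputable def envBlock (e : E.App ⊕ E.Adv) :
    List ((E.App ⊕ E.Adv) ⊕ ({e // (E.mover e).isSome} × Fin 6)) :=
  if h : (E.mover e).isSome then
    [.inr (⟨e, h⟩, 0), .inr (⟨e, h⟩, 1), .inr (⟨e, h⟩, 2), .inl e, .inr (⟨e, h⟩, 3),
      .inr (⟨e, h⟩, 4), .inr (⟨e, h⟩, 5)]
  else [.inl e]

noncomputable def realBlock : (E.App ⊕ E.Adv) ⊕ P.body.Idx →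
    List (((E.App ⊕ E.Adv) ⊕ ({e // (E.mover e).isSome} × Fin 6)) ⊕ P.body.Idx)
  | .inl e => (E.envBlock e).map .inl
  | .inr p => [.inr p]

theorem isBlocks_envBlock : IsBlocks E.redProj E.redPos E.envBlock where
  mem e i := by
    unfold envBlock
    split_ifs with h
    · rcases i with f | ⟨⟨f, hf⟩, k⟩
      · simp [redProj]
      · simp only [List.mem_cons, List.not_mem_nil, or_false, reduceCtorEq, false_or, Sum.inr.injEq,
          Prod.mk.injEq, Subtype.mk.injEq, redProj]
        constructor
        · rintro (h | h | h | h | h | h) <;> exact h.1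
        · rintro rfl
          fin_cases k <;> simp
    · rcases i with f | ⟨⟨f, hf⟩, k⟩
      · simp [redProj]
      · simp only [List.mem_singleton, reduceCtorEq, redProj, false_iff]
        rintro rfl
        exact h hf
  sorted e := by
    unfold envBlock
    split_ifs with h
    · simp [redPos]
    · simp

theorem isBlocks_realBlock : IsBlocks (Sum.map E.redProj id)
    (Sum.elim E.redPos fun _ : P.body.Idx => 0) E.realBlock where
  mem e i := by
    rcases e with e | p <;> rcases i with i | q
    · simp [realBlock, E.isBlocks_envBlock.mem]
    · simp [realBlock]
    · simp [realBlock]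
    · simp [realBlock]
  sorted e := by
    rcases e with e | p
    · exact List.pairwise_map.2 (E.isBlocks_envBlock.sorted e)
    · simp [realBlock]

variable {E}

/-- The six moves have a single outcome each, so the only branching in the block is that of the
original gate, and `Slot.kraus_forward` applies for every outcome. -/
theorem probZero_envBlock (hE : E.Valid I) (hP : P.WellFormed) (Z : Reg) (e : E.App ⊕ E.Adv)
    (l : List Gate) {s : State} (hs : ∀ c ∈ s.support, Clean (E.bound I) c) :
    probZero Z ((E.envBlock e).map (E.redGate I) ++ l) s =
      ∑ x ∈ Finset.range (E.gate e).op.numOut, probZero Z l ((E.gate e).kraus x s) := by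
  have hn : ((E.gate e).rename (E.slot I e).ren).op.numOut = (E.gate e).op.numOut :=
    Op.numOut_rename _ _
  unfold envBlock
  split_ifs with h
  · have hf : ∀ k, (Gate.guarded (P.status (E.moverRole ⟨e, h⟩)).advGuard
        ((E.slot I e).forward (E.gate e) k)).op.numOut = 1 := fun k => Slot.numOut_forward _ _ _
    simp only [List.map_cons, List.map_nil, List.cons_append, List.nil_append, redGate]
    rw [probZero_cons_of_numOut Z (hf 0), probZero_cons_of_numOut Z (hf 1),
      probZero_cons_of_numOut Z (hf 2), probZero, hn]
    refine Finset.sum_congr rfl fun x _ => ?_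
    rw [probZero_cons_of_numOut Z (hf 3), probZero_cons_of_numOut Z (hf 4),
      probZero_cons_of_numOut Z (hf 5), Slot.kraus_forward (σ := E.slot I e)]
    · exact Status.advGuard_subset (mover_advGate hE (moverRole_spec ⟨e, h⟩))
    · exact fun p hp hd => (hP.corr_fresh _ (Protocol.mem_corr_of_mem_advGuard hp)).1
        (slot_internal _ hd)
    · exact fun y hy => lt_bound (.inr (.inl ⟨e, hy⟩))
    · exact hs
  · simp only [List.map_cons, List.map_nil, List.cons_append, List.nil_append, redGate]
    rw [probZero, hn]
    refine Finset.sum_congr rfl fun x _ => ?_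
    congr 1
    -- Without a mover the slot is empty, and the gate has not been changed.
    have hid : (E.slot I e).ren.act = id := by
      funext c y
      apply Fin.ext
      refine c.val_congr (Slot.ren_of_notMem _ fun hy => ?_)
      have hnone : E.mover e = none := by simpa using h
      obtain hd | ⟨z, hd, -⟩ := (Slot.mem_supp _).1 hy
      · exact (mem_slot.1 hd).2.2 hnone
      · exact (mem_slot.1 hd).2.2 hnone
    rw [Gate.kraus_rename, hid, Finsupp.mapDomain_id, Finsupp.mapDomain_id]

/-- Induction along the execution; clean copies are an invariant, as the gates of `E` and `P` only
use names below the bound. -/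
theorem probZero_realBlock (hE : E.Valid I) (hP : P.WellFormed) (Z : Reg)
    (l : List ((E.App ⊕ E.Adv) ⊕ P.body.Idx))
    {s : State} (hs : ∀ c ∈ s.support, Clean (E.bound I) c) :
    probZero Z ((l.flatMap E.realBlock).map (Sum.elim (E.redGate I) P.body.gate)) s =
      probZero Z (l.map (Sum.elim E.gate P.body.gate)) s := by
  induction l generalizing s with
  | nil => rfl
  | cons i l ih =>
    rw [List.flatMap_cons, List.map_append, List.map_cons, probZero]
    have hclean : ∀ x, ∀ c ∈ ((Sum.elim E.gate P.body.gate i).kraus x s).support,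
        Clean (E.bound I) c := by
      refine fun x => Gate.clean_kraus (fun y hy => ?_) hs
      rcases i with e | p
      · exact lt_bound (.inr (.inl ⟨e, hy⟩))
      · exact lt_bound (.inr (.inr (.inl (hP.body_regs p y hy))))
    rcases i with e | p
    · have h1 : (E.realBlock (.inl e)).map (Sum.elim (E.redGate I) P.body.gate) =
          (E.envBlock e).map (E.redGate I) := by
        rw [realBlock, List.map_map]
        rfl
      rw [h1, probZero_envBlock hE hP Z e _ hs]
      exact Finset.sum_congr rfl fun x _ => ih (hclean x)
    · exact Finset.sum_congr rfl fun x _ => ih (hclean x)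

/-- One matching execution suffices, because `Close` for the reduction covers all of its executions.
The copies are zero initially, since they are not registers in `E.own`. -/
theorem exists_execution_red (hE : E.Valid I) (hP : P.WellFormed) {v : Config} (hv : E.Initial v)
    {l : List E.real.Idx} (hl : E.real.IsExecution v l) :
    ∃ l', (E.red I).real.IsExecution v l' ∧
      (E.red I).real.prob E.Z v l' = E.real.prob E.Z v l := by
  refine ⟨l.flatMap E.realBlock, Circuit.isExecution_iff.2 ?_, probZero_realBlock hE hP _ _ ?_⟩
  · exact E.isBlocks_realBlock.isListing_flatMap (hE.isCircuit_real.order v).1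
      (Circuit.isExecution_iff.1 hl)
  · intro c hc y hy
    obtain rfl := Finset.mem_singleton.1 (Finsupp.support_single_subset hc)
    exact hv y fun h => (lt_bound (.inl h)).not_ge hy

end Env

/-! ### From ideal adversaries against the reduction to simulators -/

/-- An order in which the gates of a circuit can be executed. -/
noncomputable def Circuit.IsCircuit.listing {C : Circuit} (h : C.IsCircuit) (v : Config) :
    List C.Idx :=
  (h.order v).exists_isListing.choose

theorem Circuit.IsCircuit.isListing {C : Circuit} (h : C.IsCircuit) (v : Config) :
    IsListing (C.lt v) (h.listing v) :=
  (h.order v).exists_isListing.choose_spec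

namespace IdealAdv

variable {P : Protocol} {I : IdealProtocol P} {E : Env P} (A : IdealAdv I (E.red I))

/-- The gates of the simulator: those of the ideal adversary, and exchanges of registers before and
after each gate of the environment. -/
noncomputable def simGate : A.Idx ⊕ (E.App ⊕ E.Adv) × Fin 4 → Gate
  | .inl a => A.gate a
  | .inr s => (E.slot I s.1).exchangeGate (![true, false, false, true] s.2)

def simProj : ((E.App ⊕ E.Adv) ⊕ (A.Idx ⊕ (E.App ⊕ E.Adv) × Fin 4)) ⊕ I.body.Idx → A.ideal.Idx
  | .inl (.inl e) => .inl (.inl e)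
  | .inl (.inr (.inl a)) => .inl (.inr a)
  | .inl (.inr (.inr s)) => .inl (.inl s.1)
  | .inr i => .inr i

/-- Position 2 is that of the environment gate, between two exchanges on either side. -/
def simPos : ((E.App ⊕ E.Adv) ⊕ (A.Idx ⊕ (E.App ⊕ E.Adv) × Fin 4)) ⊕ I.body.Idx → ℕ
  | .inl (.inl _) => 2
  | .inl (.inr (.inl _)) => 0
  | .inl (.inr (.inr s)) => if (s.2 : ℕ) < 2 then s.2 else s.2 + 1
  | .inr _ => 0

def simBlock : A.ideal.Idx →
    List (((E.App ⊕ E.Adv) ⊕ (A.Idx ⊕ (E.App ⊕ E.Adv) × Fin 4)) ⊕ I.body.Idx)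
  | .inl (.inl e) => [.inl (.inr (.inr (e, 0))), .inl (.inr (.inr (e, 1))), .inl (.inl e),
      .inl (.inr (.inr (e, 2))), .inl (.inr (.inr (e, 3)))]
  | .inl (.inr a) => [.inl (.inr (.inl a))]
  | .inr i => [.inr i]

theorem isBlocks_simBlock : IsBlocks A.simProj A.simPos A.simBlock where
  mem i j := by
    rcases i with (e | a) | i
    · rcases j with (f | a | ⟨f, k⟩) | j
      · have h : A.simProj (.inl (.inl f)) = Sum.inl (Sum.inl e) ↔ f = e :=
          ⟨fun h => Sum.inl_injective (Sum.inl_injective h),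
            fun h => congrArg (fun e => Sum.inl (Sum.inl e)) h⟩
        rw [h]
        simp only [simBlock, List.mem_cons, reduceCtorEq, Sum.inl.injEq, List.not_mem_nil, or_false,
          false_or]
        exact ⟨fun h => Sum.inl_injective h, fun h => congrArg Sum.inl h⟩
      · refine iff_of_false (by simp [simBlock]) fun h => ?_
        cases h
      · have h : A.simProj (.inl (.inr (.inr (f, k)))) = Sum.inl (Sum.inl e) ↔ f = e :=
          ⟨fun h => Sum.inl_injective (Sum.inl_injective h),
            fun h => congrArg (fun e => Sum.inl (Sum.inl e)) h⟩
        rw [h]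
        simp only [simBlock, List.mem_cons, Sum.inl.injEq, Sum.inr.injEq, reduceCtorEq, false_or, List.not_mem_nil, or_false]
        constructor
        · rintro (h | h | h | h) <;> exact congrArg Prod.fst h
        · rintro rfl
          fin_cases k <;> simp
      · refine iff_of_false (by simp [simBlock]) fun h => ?_
        cases h
    · rcases j with (f | b | ⟨f, k⟩) | j
      · refine iff_of_false (by simp [simBlock]) fun h => ?_
        cases h
      · simp only [simBlock, List.mem_singleton, Sum.inl.injEq, Sum.inr.injEq]
        exact ⟨fun h => congrArg (fun e => Sum.inl (Sum.inr e)) h,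
          fun h => Sum.inr_injective (Sum.inl_injective h)⟩
      · refine iff_of_false (by simp [simBlock]) fun h => ?_
        cases h
      · refine iff_of_false (by simp [simBlock]) fun h => ?_
        cases h
    · rcases j with (f | b | ⟨f, k⟩) | j
      · refine iff_of_false (by simp [simBlock]) fun h => ?_
        cases h
      · refine iff_of_false (by simp [simBlock]) fun h => ?_
        cases h
      · refine iff_of_false (by simp [simBlock]) fun h => ?_
        cases h
      · simp only [simBlock, List.mem_singleton, Sum.inr.injEq]
        exact ⟨fun h => congrArg Sum.inr h, fun h => Sum.inr_injective h⟩
  sorted i := by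
    rcases i with (e | a) | i <;> simp [simBlock, simPos]

variable {A}

open Classical in
/-- The simulator which exchanges, before and after each gate of the environment, registers of the
protocol with those that the ideal adversary offers. -/
noncomputable def Valid.toSimulator (hA : A.Valid) : Simulator I E where
  Idx := A.Idx ⊕ (E.App ⊕ E.Adv) × Fin 4
  fin := inferInstance
  gate := A.simGate
  -- The given order is first made linear. The exchanges touch both a register and its copy, while
  -- the renamed gate need not touch the register, so gates of the ideal adversary using that
  -- register may be unordered with it; a block must still run uninterrupted.
  ord v := Lex A.simProj A.simPos fun i j =>
    (hA.isCircuit.listing v).idxOf i < (hA.isCircuit.listing v).idxOf j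

theorem Valid.lex_of_ord (hA : A.Valid) {v : Config} {i j : hA.toSimulator.ideal.Idx}
    (h : A.ord v (A.simProj i) (A.simProj j)) : hA.toSimulator.ord v i j := by
  classical
  exact .inl ((hA.isCircuit.isListing v).idxOf_lt (hA.isCircuit.order v) h)

/-- Everything the simulator exchanges is an internal register of `P`, free on the ideal side, or a
fresh copy. Hence the exchanges need no corrupted circuit and carry no guard. -/
theorem notMem_supp_slot (hP : P.WellFormed) (hI : I.WellFormed) {e : E.App ⊕ E.Adv} {y : Reg}
    (hy : y ∈ (E.slot I e).supp) :
    y ∉ P.io ∧ y ∉ P.corr ∧ y ∉ I.internal ∧ y ∉ E.regs := by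
  obtain h | ⟨z, -, rfl⟩ := (Slot.mem_supp _).1 hy
  · have hi := Env.slot_internal y h
    exact ⟨hP.internal_io hi, fun hc => (hP.corr_fresh y hc).1 hi,
      fun hI' => hI.internal_fresh y hI' (.inl hi), fun h => h.2 (.inl hi)⟩
  · exact ⟨fun h => Env.copy_notMem_regs z (.inr (.inl h)),
      fun h => Env.copy_notMem_regs z (.inr (.inr h)),
      fun h => Env.copy_fresh (E := E) (.inr (.inr (.inr h))) rfl,
      fun h => Env.copy_fresh (I := I) (h.1.imp_right fun h => .inl h) rfl⟩

/-- Comparability is free in a linear order. Activation registers of `I(P)` lie outside all slots,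
so renaming does not affect who sets them and exchanges never do. -/
theorem Valid.valid_toSimulator (hP : P.WellFormed) (hI : I.WellFormed) (hA : A.Valid) :
    hA.toSimulator.Valid where
  isCircuit :=
    { order := fun v => by
        classical
        exact (IsListing.strictOrder_idxOf _).lex
      comparable := fun v i j hij _ => by
        classical
        exact A.isBlocks_simBlock.lex_total (fun _ _ => (hA.isCircuit.isListing v).idxOf_total) i j hij }
  ord_env v e f h := hA.lex_of_ord (hA.ord_app v e f (.inl h))
  ord_protocol v p q h := hA.lex_of_ord (hA.ord_protocol v p q h)
  activated v p a hp j hj hm := by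
    have hch := (hI.protocol.act_guard p a hp).2
    have hns : ∀ e, a ∉ (E.slot I e).supp := fun e ha => by
      obtain ⟨h1, -, h2, -⟩ := notMem_supp_slot hP hI ha
      exact hch.elim (fun h => h2 (.inr h)) fun h => h1 (hI.io_subset h)
    refine hA.lex_of_ord (hA.activated v p a hp _ ?_ ?_)
    · rcases j with (e | s | s) | q
      · exact Sum.inl_ne_inr
      · exact Sum.inl_ne_inr
      · exact Sum.inl_ne_inr
      · exact fun h => hj (congrArg Sum.inr (Sum.inr_injective h))
    · rcases j with (e | s | s) | q
      · have := Gate.Modifies.rename (g := E.gate e) (E.slot I e).ren hm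
        rwa [Slot.ren_of_notMem _ (hns e)] at this
      · exact hm
      · exact absurd (Slot.regs_exchangeGate hm.mem_regs) (hns s.1)
      · exact hm
  access s := by
    rcases s with s | s
    · exact hA.access s
    · have h : ∀ y ∈ (A.simGate (.inr s)).regs, _ := fun y hy =>
        notMem_supp_slot hP hI (Slot.regs_exchangeGate hy)
      exact ⟨fun y hy => (h y ((Gate.mem_regs _).2 (.inr hy))).2.1,
        .inl fun y hy => ⟨(h y hy).1, (h y hy).2.2.1⟩⟩
  env_fresh s y hy := by
    rcases s with s | s
    -- The own registers of the reduction are exactly the registers of `E` outside `P`, which is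
    -- what a simulator must avoid.
    · exact fun h => hA.own_fresh s y hy (Env.mem_red_own.2 h)
    · exact (notMem_supp_slot hP hI (Slot.regs_exchangeGate hy)).2.2.2

/-- Conjugation by exchanges is the renaming on every state, so unlike on the analysed side no
cleanness is required, whatever the ideal adversary writes into the copies. -/
theorem probZero_simBlock (hA : A.Valid) (Z : Reg) (l : List A.ideal.Idx) (s : State) :
    probZero Z ((l.flatMap A.simBlock).map hA.toSimulator.ideal.gate) s =
      probZero Z (l.map A.ideal.gate) s := by
  induction l generalizing s with
  | nil => rfl
  | cons i l ih =>
    have h1 : ((i :: l).flatMap A.simBlock).map hA.toSimulator.ideal.gate =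
        (A.simBlock i).map hA.toSimulator.ideal.gate ++
          (l.flatMap A.simBlock).map hA.toSimulator.ideal.gate := by
      rw [List.flatMap_cons]
      exact List.map_append
    rw [h1]
    rcases i with (e | a) | i
    · change probZero Z ((E.slot I e).exchangeGate true :: (E.slot I e).exchangeGate false ::
        E.gate e :: (E.slot I e).exchangeGate false :: (E.slot I e).exchangeGate true :: _) s =
        probZero Z ((E.gate e).rename (E.slot I e).ren :: l.map A.ideal.gate) s
      have hn : ((E.gate e).rename (E.slot I e).ren).op.numOut = (E.gate e).op.numOut :=
        Op.numOut_rename _ _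
      rw [probZero_cons_of_numOut Z (Slot.numOut_exchangeGate _),
        probZero_cons_of_numOut Z (Slot.numOut_exchangeGate _), probZero, probZero, hn]
      refine Finset.sum_congr rfl fun x _ => ?_
      rw [probZero_cons_of_numOut Z (Slot.numOut_exchangeGate _),
        probZero_cons_of_numOut Z (Slot.numOut_exchangeGate _), Slot.kraus_exchange]
      exact ih _
    · exact Finset.sum_congr rfl fun x _ => ih _
    · exact Finset.sum_congr rfl fun x _ => ih _

/-- The linear order admits a single execution, the refinement of the chosen listing, which has the
same probability as that listing. -/
theorem Valid.close_toSimulator (hA : A.Valid) {C : Circuit} {Z : Reg} {v : Config} {ε : ℝ}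
    (h : Close C A.ideal Z v ε) : Close C hA.toSimulator.ideal Z v ε := by
  classical
  intro l m hl hm
  have hlist := hA.isCircuit.isListing v
  have hm' : m = (hA.isCircuit.listing v).flatMap A.simBlock :=
    IsListing.eq_of_total (A.isBlocks_simBlock.lex_total fun _ _ => hlist.idxOf_total)
      (Circuit.isExecution_iff.1 hm)
      (A.isBlocks_simBlock.isListing_flatMap
        (fun i => lt_irrefl ((hA.isCircuit.listing v).idxOf i)) hlist.of_idxOf)
  have hprob : hA.toSimulator.ideal.prob Z v m = A.ideal.prob Z v (hA.isCircuit.listing v) := by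
    rw [hm']
    exact probZero_simBlock hA Z _ _
  rw [hprob]
  exact h l _ hl (Circuit.isExecution_iff.2 hlist)

theorem Valid.size_toSimulator (hA : A.Valid) : hA.toSimulator.size = A.size + 4 * E.size := by
  have h : hA.toSimulator.size = Fintype.card A.Idx + Fintype.card (E.App ⊕ E.Adv) * 4 := by
    change Fintype.card (A.Idx ⊕ (E.App ⊕ E.Adv) × Fin 4) = _
    rw [Fintype.card_sum, Fintype.card_prod, Fintype.card_fin]
  rw [h, mul_comm]
  rfl

end IdealAdv

/-! ### Consequences for security -/

variable {P : Protocol} {I : IdealProtocol P}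

/-- A good ideal adversary against the reduction yields a good simulator. -/
theorem exists_simulator_of_red (hPI : WellFormedPair P I) {E : Env P} (hE : E.Valid I) {ε : ℝ}
    {A : IdealAdv I (E.red I)} (hA : A.Valid)
    (h : ∀ v, (E.red I).Initial v → Close (E.red I).real A.ideal (E.red I).Z v ε) :
    ∃ S : Simulator I E, S.Valid ∧ S.size = A.size + 4 * E.size ∧
      ∀ v, E.Initial v → Close E.real S.ideal E.Z v ε := by
  refine ⟨hA.toSimulator, hA.valid_toSimulator hPI.1 hPI.2, hA.size_toSimulator, fun v hv => ?_⟩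
  refine hA.close_toSimulator fun l m hl hm => ?_
  obtain ⟨l', hl', hp⟩ := Env.exists_execution_red hE hPI.1 hv hl
  rw [← hp]
  exact h v (Env.initial_red hE hv) l' m hl' hm

/-- A good simulator is part of a good ideal adversary. -/
theorem exists_idealAdv {E : Env P} (hE : E.Valid I) {ε : ℝ} {S : Simulator I E} (hS : S.Valid)
    (h : ∀ v, E.Initial v → Close E.real S.ideal E.Z v ε) :
    ∃ A : IdealAdv I E, A.Valid ∧ A.size ≤ E.size + S.size ∧
      ∀ v, E.Initial v → Close E.real A.ideal E.Z v ε :=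
  ⟨S.toIdealAdv, hS.toIdealAdv hE, S.size_toIdealAdv, fun v hv =>
    Simulator.close_toIdealAdv (h v hv)⟩

theorem Realizes.mono {K K' : Env P → Prop} {ε : Env P → ℝ} (h : Realizes I K ε)
    (hK : ∀ E, K' E → K E) : Realizes I K' ε :=
  fun E hE hE' => h E hE (hK E hE')

theorem Realizes.altRealizes {K : Env P → Prop} {ε : Env P → ℝ} (h : Realizes I K ε) :
    AltRealizes I K ε := by
  intro E hE hK
  obtain ⟨S, hS, hc⟩ := h E hE hK
  obtain ⟨A, hA, -, hc'⟩ := exists_idealAdv hE hS hc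
  exact ⟨A, hA, hc'⟩

/-- Only reduced environments are tested, so security against any class containing them is enough.
-/
theorem AltRealizes.realizes (hPI : WellFormedPair P I) {K : Env P → Prop} {ε : Env P → ℝ}
    (h : AltRealizes I K ε) (hK : ∀ E : Env P, E.Valid I → K (E.red I)) :
    Realizes I allEnv fun E => ε (E.red I) := by
  intro E hE _
  obtain ⟨A, hA, hc⟩ := h _ (hE.red hPI.1) (hK E hE)
  obtain ⟨S, hS, -, hc'⟩ := exists_simulator_of_red hPI hE hA hc
  exact ⟨S, hS, hc'⟩

/-! ### The computational scenario -/

theorem PolyBounded.add {f g : ℕ → ℕ} (hf : PolyBounded f) (hg : PolyBounded g) :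
    PolyBounded fun n => f n + g n := by
  obtain ⟨p, hp⟩ := hf
  obtain ⟨q, hq⟩ := hg
  exact ⟨p + q, fun n => by rw [Polynomial.eval_add]; exact add_le_add (hp n) (hq n)⟩

theorem PolyBounded.const_mul {f : ℕ → ℕ} (hf : PolyBounded f) (k : ℕ) :
    PolyBounded fun n => k * f n := by
  obtain ⟨p, hp⟩ := hf
  refine ⟨Polynomial.C k * p, fun n => ?_⟩
  rw [Polynomial.eval_mul, Polynomial.eval_C]
  exact Nat.mul_le_mul_left k (hp n)

theorem PolyBounded.of_le {f g : ℕ → ℕ} (hg : PolyBounded g) (h : ∀ n, f n ≤ g n) :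
    PolyBounded f := by
  obtain ⟨p, hp⟩ := hg
  exact ⟨p, fun n => (h n).trans (hp n)⟩

/-- The largest error for environments that are up to `κ` times as large. -/
noncomputable def scaledError (κ : ℕ) (ε : ℕ → ℕ → ℝ) (n s : ℕ) : ℝ :=
  (Finset.range (κ * s + 1)).sup' ⟨0, Finset.mem_range.2 (Nat.succ_pos _)⟩ (ε n)

theorem le_scaledError {κ : ℕ} {ε : ℕ → ℕ → ℝ} {n s t : ℕ} (h : t ≤ κ * s) :
    ε n t ≤ scaledError κ ε n s :=
  Finset.le_sup' (ε n) (Finset.mem_range.2 (Nat.lt_succ_of_le h))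

theorem Negligible.scaledError {ε : ℕ → ℕ → ℝ} (h : Negligible ε) (κ : ℕ) :
    Negligible (scaledError κ ε) := by
  intro f hf q hq
  -- The maximum is attained at some size `t n ≤ κ * f n`; this is again polynomially bounded, so
  -- negligibility applies to it.
  have hex : ∀ n, ∃ t ∈ Finset.range (κ * f n + 1), QUC.scaledError κ ε n (f n) = ε n t := fun n =>
    Finset.exists_mem_eq_sup' ⟨0, Finset.mem_range.2 (Nat.succ_pos _)⟩ (ε n)
  choose t ht hte using hex
  have hpoly : PolyBounded t := (hf.const_mul κ).of_le fun n =>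
    Nat.lt_succ_iff.1 (Finset.mem_range.1 (ht n))
  filter_upwards [h t hpoly q hq] with n hn
  rw [hte]
  exact hn

section Computational

variable {P : ℕ → Protocol} {I : (n : ℕ) → IdealProtocol (P n)}

theorem CompRealizes.mono {K K' : (n : ℕ) → Env (P n) → Prop} (h : CompRealizes I K)
    (hK : ∀ n E, K' n E → K n E) : CompRealizes I K' := by
  obtain ⟨h1, h2, ε, hε, h⟩ := h
  exact ⟨h1, h2, ε, hε, fun E hE hE' => h E hE fun n => hK n _ (hE' n)⟩

theorem CompRealizes.altCompRealizes {K : (n : ℕ) → Env (P n) → Prop} (h : CompRealizes I K) :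
    AltCompRealizes I K := by
  obtain ⟨h1, h2, ε, hε, h⟩ := h
  refine ⟨h1, h2, ε, hε, fun E hE hK hpoly => ?_⟩
  obtain ⟨S, hS, hSp, hc⟩ := h E hE hK hpoly
  choose A hA hsize hc' using fun n => exists_idealAdv (hE n) (hS n) (hc n)
  exact ⟨A, hA, (hpoly.add hSp).of_le hsize, hc'⟩

/-- The size of the reduction is bounded by `7 * E.size` but not determined by it, and `ε n` need
not be monotone; this is why the new error is a maximum over all smaller sizes. -/
theorem AltCompRealizes.compRealizes (hPI : ∀ n, WellFormedPair (P n) (I n))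
    {K : (n : ℕ) → Env (P n) → Prop} (h : AltCompRealizes I K)
    (hK : ∀ n (E : Env (P n)), E.Valid (I n) → K n (E.red (I n))) :
    CompRealizes I fun _ => allEnv := by
  obtain ⟨h1, h2, ε, hε, h⟩ := h
  refine ⟨h1, h2, scaledError 7 ε, hε.scaledError 7, fun E hE _ hpoly => ?_⟩
  obtain ⟨A, hA, hAp, hc⟩ := h (fun n => (E n).red (I n)) (fun n => (hE n).red (hPI n).1)
    (fun n => hK n _ (hE n)) ((hpoly.const_mul 7).of_le fun n => Env.size_red)
  choose S hS hsize hc' using fun n => exists_simulator_of_red (hPI n) (hE n) (hA n) (hc n)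
  refine ⟨S, hS, (hAp.add (hpoly.const_mul 4)).of_le fun n => (hsize n).le, fun n v hv l m hl hm => ?_⟩
  exact (hc' n v hv l m hl hm).trans (le_scaledError Env.size_red)

end Computational

end QUC

/-! ### The main theorem -/

theorem mainTheorem3 :
    -- error bound that may depend on the environment, with a reduction to a dummy adversary
    (∃ κ : ℕ, ∀ (P : QUC.Protocol) (I : QUC.IdealProtocol P), QUC.WellFormedPair P I →
      (∀ ε : QUC.Env P → ℝ, QUC.Realizes I QUC.allEnv ε → QUC.AltRealizes I QUC.allEnv ε) ∧
      ∃ red : QUC.Env P → QUC.Env P,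
        (∀ E : QUC.Env P, E.Valid I →
          (red E).Valid I ∧ (red E).IsDummy ∧ (red E).size ≤ κ * E.size ∧
            (P.HasEve → (red E).NoDirectChannel)) ∧
        ∀ ε : QUC.Env P → ℝ,
          (QUC.AltRealizes I QUC.allEnv ε → QUC.Realizes I QUC.allEnv (fun E => ε (red E))) ∧
          (QUC.Realizes I QUC.dummyEnv ε → QUC.Realizes I QUC.allEnv (fun E => ε (red E))) ∧
          (P.HasEve → QUC.Realizes I QUC.noChannelEnv ε →
            QUC.Realizes I QUC.allEnv (fun E => ε (red E)))) ∧
    -- unconditional scenario: error bound that does not depend on the environment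
    (∀ (P : QUC.Protocol) (I : QUC.IdealProtocol P), QUC.WellFormedPair P I → ∀ ε : ℝ,
      [QUC.Realizes I QUC.allEnv (fun _ => ε), QUC.Realizes I QUC.dummyEnv (fun _ => ε),
        QUC.AltRealizes I QUC.allEnv (fun _ => ε)].TFAE ∧
      (P.HasEve →
        (QUC.Realizes I QUC.noChannelEnv (fun _ => ε) ↔ QUC.Realizes I QUC.allEnv (fun _ => ε)))) ∧
    -- computational scenario
    (∀ (P : ℕ → QUC.Protocol) (I : (n : ℕ) → QUC.IdealProtocol (P n)),
      (∀ n, QUC.WellFormedPair (P n) (I n)) →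
      [QUC.CompRealizes I (fun _ => QUC.allEnv), QUC.CompRealizes I (fun _ => QUC.dummyEnv),
        QUC.AltCompRealizes I (fun _ => QUC.allEnv)].TFAE ∧
      ((∀ n, (P n).HasEve) →
        (QUC.CompRealizes I (fun _ => QUC.noChannelEnv) ↔
          QUC.CompRealizes I (fun _ => QUC.allEnv)))) := by
  -- The constant `7` counts a gate and the six moves around it. Each implication from a smaller
  -- class passes through the alternative definition and back through the reduction.
  refine ⟨⟨7, fun P I hPI => ⟨fun ε h => h.altRealizes, fun E => E.red I, fun E hE => ?_,
    fun ε => ⟨fun h => ?_, fun h => ?_, fun hEve h => ?_⟩⟩⟩, fun P I hPI ε => ⟨?_, fun hEve => ?_⟩,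
    fun P I hPI => ⟨?_, fun hEve => ?_⟩⟩
  · exact ⟨hE.red hPI.1, QUC.Env.isDummy_red hPI.1, QUC.Env.size_red,
      QUC.Env.noDirectChannel_red hPI.1 hE⟩
  · exact h.realizes hPI fun _ _ => trivial
  · exact h.altRealizes.realizes hPI fun _ _ => QUC.Env.isDummy_red hPI.1
  · exact h.altRealizes.realizes hPI fun _ hE => QUC.Env.noDirectChannel_red hPI.1 hE hEve
  · tfae_have 1 → 2 := fun h => h.mono fun _ _ => trivial
    tfae_have 2 → 1 := fun h =>
      h.altRealizes.realizes hPI fun _ _ => QUC.Env.isDummy_red hPI.1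
    tfae_have 1 → 3 := fun h => h.altRealizes
    tfae_have 3 → 1 := fun h => h.realizes hPI fun _ _ => trivial
    tfae_finish
  · exact ⟨fun h => h.altRealizes.realizes hPI fun _ hE =>
      QUC.Env.noDirectChannel_red hPI.1 hE hEve, fun h => h.mono fun _ _ => trivial⟩
  · tfae_have 1 → 2 := fun h => h.mono fun _ _ _ => trivial
    tfae_have 2 → 1 := fun h =>
      h.altCompRealizes.compRealizes hPI fun n _ _ => QUC.Env.isDummy_red (hPI n).1
    tfae_have 1 → 3 := fun h => h.altCompRealizes
    tfae_have 3 → 1 := fun h => h.compRealizes hPI fun _ _ _ => trivial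
    tfae_finish
  · exact ⟨fun h => h.altCompRealizes.compRealizes hPI fun n _ hE =>
      QUC.Env.noDirectChannel_red (hPI n).1 hE (hEve n), fun h => h.mono fun _ _ _ => trivial⟩
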